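/- For a finite-dimensional real Banach space $X$ with unit sphere $S_X$ and closed dual unit ball $B_{X^*}$, let $H_\alpha(X)$ (the antipodal Hadwiger number) be the largest cardinality of a set $S\subseteq S_X$ such that for all $x\neq y$ in $S$ there is $f\in B_{X^*}$ with $1\le f(x)-f(y)$ and $f(y)\le f(z)\le f(x)$ for every $z\in S$; let $H'_\alpha(X)$ (the strict antipodal Hadwiger number) be defined in the same way with $1<f(x)-f(y)$ in place of $1\le f(x)-f(y)$. Let $\ell_p^n$ denote $\mathbb{R}^n$ with the $p$-norm. Let $1<p\le\infty$. Then the following hold. 1. If $n=2$ or $n=3$, then $H'_\alpha(\ell_p^n)=4n-4=2^n=H_\alpha(\ell_p^n)$. 2. If $n\ge 4$, then: (a) $H'_\alpha(\ell_p^n)\ge 4n-4$; (b) if $2\le p<\log_2 n$, then $4n-4\le H'_\alpha(\ell_p^n)\le H_\alpha(\ell_p^n)<2^n$; (c) if $p=\log_2 n$, then $4n-4\le H'_\alpha(\ell_p^n)<2^n=H_\alpha(\ell_p^n)$; in particular, for $n=4$ we have $p=\log_2 4=2$ and $12\le H'_\alpha(\ell_2^4)<16=H_\alpha(\ell_2^4)$;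 (d) if $p>\log_2 n$, then $H'_\alpha(\ell_p^n)=2^n=H_\alpha(\ell_p^n)$. -/

import Mathlib

open scoped ENNReal

/-- `S` is a set of unit vectors of `X` such that any two distinct points `x, y` of `S` lie on
parallel support hyperplanes of `S` given by a functional `f` in the closed unit ball of the
(continuous) dual with `f x - f y ≥ 1`. -/
def IsAntipodalHadwiger {X : Type*} [NormedAddCommGroup X] [NormedSpace ℝ X] (S : Set X) : Prop :=
  S ⊆ Metric.sphere (0 : X) 1 ∧
    ∀ x ∈ S, ∀ y ∈ S, x ≠ y →
      ∃ f : StrongDual ℝ X, ‖f‖ ≤ 1 ∧ 1 ≤ f x - f y ∧ ∀ z ∈ S, f y ≤ f z ∧ f z ≤ f x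

/-- The strict version of `IsAntipodalHadwiger`: the functional satisfies `f x - f y > 1`. -/
def IsStrictAntipodalHadwiger {X : Type*} [NormedAddCommGroup X] [NormedSpace ℝ X]
    (S : Set X) : Prop :=
  S ⊆ Metric.sphere (0 : X) 1 ∧
    ∀ x ∈ S, ∀ y ∈ S, x ≠ y →
      ∃ f : StrongDual ℝ X, ‖f‖ ≤ 1 ∧ 1 < f x - f y ∧ ∀ z ∈ S, f y ≤ f z ∧ f z ≤ f x

/-- The antipodal Hadwiger number of `X`, valued in `ℕ∞`. A supremum in `ℕ∞` that is finite is
attained, so whenever the value is finite it is the largest cardinality of such a set. -/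
noncomputable def antipodalHadwiger (X : Type*) [NormedAddCommGroup X] [NormedSpace ℝ X] : ℕ∞ :=
  ⨆ (S : Set X) (_ : IsAntipodalHadwiger S), S.encard

/-- The strict antipodal Hadwiger number of `X`, valued in `ℕ∞`. -/
noncomputable def strictAntipodalHadwiger (X : Type*) [NormedAddCommGroup X]
    [NormedSpace ℝ X] : ℕ∞ :=
  ⨆ (S : Set X) (_ : IsStrictAntipodalHadwiger S), S.encard

/-- The real space `ℓ_p^n`: `ℝⁿ` with the `p`-norm, `1 ≤ p ≤ ∞`. -/
abbrev EllP (p : ℝ≥0∞) (n : ℕ) : Type := PiLp p (fun _ : Fin n => ℝ)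

/-- `log₂ n` as an extended nonnegative real (for `n ≥ 1` the logarithm is nonnegative). -/
noncomputable def logTwo (n : ℕ) : ℝ≥0∞ := ENNReal.ofReal (Real.logb 2 (n : ℝ))

/-! Upper bounds. Let P be the convex hull of an antipodal set S in dimension n. The copies of P
shrunk by 1/2 towards the points of S lie in P and overlap only in null sets, so |S| ≤ 2^n
(Danzer–Grünbaum). If |S| = 2^n, the copies tile P up to a null set. For an affine d ≥ 0 vanishing
on a facet, the volume h of the slice {d ≤ t} of P then satisfies 2^n h(t) = ∑ h(2t - d x) over x in
S, and `shift_eq_zero_or_eq_max_of_selfSimilar` deduces that d takes only two values on S. Taking n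
independent facet functionals embeds S into the n-bit patterns; by counting, every pattern occurs,
so S is the vertex set of a parallelotope (`IsAntipodalSet.exists_parallelotope`).

For 2 ≤ p < ∞, Clarkson's inequality summed over the vertices of this parallelotope, all of norm 1,
gives ∑ ‖w i‖^p ≤ 2^p for its edges w i (`EllP.exists_edges`). Each edge joins two points of S, so
it has norm at least 1, and more than 1 in the strict case. Hence n ≤ 2^p, respectively n < 2^p.

Lower bounds. The cube vertices with coordinates ± n^(-1/p) are separated by coordinate functionals
with gap 2 n^(-1/p), which is at least 1 exactly when n ≤ 2^p. For every finite p > 1, the 4(n - 1)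
vertices of a prism over a cross-polytope are strictly separated; for p = ∞ the cube suffices. -/

open MeasureTheory AffineMap Module

/-! ### Rigidity of a self-similar function of one variable -/

/-- A function that is self-similar at ratio `2` with respect to the shifts `d x` and has at least
linear growth at `0` only allows the extreme shifts, provided its increments are monotone up to the
factor of a homothety centred at the largest shift. -/
theorem shift_eq_zero_or_eq_max_of_selfSimilar {X : Type*} (S : Finset X) (d : X → ℝ) (n : ℕ)
    (h : ℝ → ℝ) (w : ℝ) (hw : 0 < w) (hcard : S.card = 2 ^ n) (hd : ∀ x ∈ S, 0 ≤ d x)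
    (hdw : ∀ x ∈ S, d x ≤ w)
    (hneg : ∀ t < 0, h t = 0) (hmono : Monotone h)
    (hself : ∀ t, 2 ^ n * h t = ∑ x ∈ S, h (2 * t - d x))
    (hhom : ∀ l a b : ℝ, 0 < l → l ≤ 1 → a ≤ b →
      l ^ n * (h b - h a) ≤ h (w - l * (w - b)) - h (w - l * (w - a)))
    (hlow : ∃ c > 0, ∀ t, 0 ≤ t → t ≤ w → c * t ≤ h t) :
    ∀ x ∈ S, d x = 0 ∨ d x = w := by
  classical
  by_contra! hcon
  obtain ⟨x₀, hx₀, hx₀0, hx₀w⟩ := hcon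
  obtain ⟨c, hc, hlow⟩ := hlow
  set N : ℝ := 2 ^ n with hN
  have hNpos : 0 < N := by positivity
  -- the smallest positive shift
  obtain ⟨z, hz, hzmin⟩ := Finset.exists_min_image (S.filter (fun x => d x ≠ 0)) d
    ⟨x₀, by simp [hx₀, hx₀0]⟩
  obtain ⟨hzS, hz0⟩ := Finset.mem_filter.1 hz
  set δ := d z with hδ
  have hδpos : 0 < δ := lt_of_le_of_ne (hd z hzS) (Ne.symm hz0)
  have hδw : δ < w := lt_of_le_of_lt (hzmin x₀ (by simp [hx₀, hx₀0]))
    (lt_of_le_of_ne (hdw x₀ hx₀) hx₀w)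
  have hδle : ∀ x ∈ S, d x ≠ 0 → δ ≤ d x := fun x hx hx0 => hzmin x (by simp [hx, hx0])
  have hnonneg : ∀ t, 0 ≤ h t := fun t => by
    rcases lt_or_ge t 0 with ht | ht
    · exact (hneg t ht).ge
    · rw [← hneg (-1) (by norm_num)]; exact hmono (by linarith)
  set m : ℝ := ((S.filter (fun x => d x = 0)).card : ℝ) with hm
  have hsplit : ∀ t, N * h t = m * h (2 * t) +
      ∑ x ∈ S.filter (fun x => d x ≠ 0), h (2 * t - d x) := by
    intro t
    rw [hself, ← Finset.sum_filter_add_sum_filter_not S (fun x => d x = 0)]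
    congr 1
    rw [Finset.sum_congr rfl (g := fun _ => h (2 * t))]
    · simp [hm]
    · intro x hx
      rw [(Finset.mem_filter.1 hx).2, sub_zero]
  have hmN : m < N := by
    have : (S.filter (fun x => d x = 0)).card < S.card :=
      Finset.card_lt_card (Finset.filter_ssubset.2 ⟨x₀, hx₀, hx₀0⟩)
    rw [hcard] at this
    rw [hm, hN]; exact_mod_cast this
  have h0 : h 0 = 0 := by
    have h1 := hsplit 0
    rw [Finset.sum_eq_zero, mul_zero, add_zero] at h1
    · have : (N - m) * h 0 = 0 := by linarith
      rcases mul_eq_zero.1 this with h2 | h2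
      · linarith
      · exact h2
    · intro x hx
      obtain ⟨hxS, hx0⟩ := Finset.mem_filter.1 hx
      have := hδle x hxS hx0
      exact hneg _ (by linarith)
  have hzero : ∀ t ≤ 0, h t = 0 := fun t ht =>
    le_antisymm (h0 ▸ hmono ht) (hnonneg t)
  -- Below δ / 2 only the m vanishing shifts contribute, so h is multiplied by m / N under halving.
  have hscale : ∀ t, 2 * t ≤ δ → N * h t = m * h (2 * t) := by
    intro t ht
    rw [hsplit t, Finset.sum_eq_zero, add_zero]
    intro x hx
    obtain ⟨hxS, hx0⟩ := Finset.mem_filter.1 hx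
    have := hδle x hxS hx0
    exact hzero _ (by linarith)
  have hpos : ∀ t, 0 < t → 0 < h t := by
    intro t ht
    have h1 := hlow (min t w) (by positivity) (min_le_right _ _)
    have h2 : 0 < c * min t w := by positivity
    exact lt_of_lt_of_le (lt_of_lt_of_le h2 h1) (hmono (min_le_left _ _))
  -- The homothety centred at w with ratio 1 - a / w moves 0 to a, so it carries the increment over
  -- [0, b] into [a, a + b].
  have hshift : ∀ a b, 0 ≤ a → a < w → 0 ≤ b →
      h a + (1 - a / w) ^ n * h b ≤ h (a + b) := by
    intro a b ha haw hb
    have hl : 0 < 1 - a / w := by rw [sub_pos, div_lt_one hw]; exact haw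
    have hl1 : 1 - a / w ≤ 1 := by have : 0 ≤ a / w := by positivity
                                   linarith
    have h1 := hhom (1 - a / w) 0 b hl hl1 hb
    have e1 : w - (1 - a / w) * (w - 0) = a := by field_simp; ring
    have e2 : w - (1 - a / w) * (w - b) ≤ a + b := by
      have : w - (1 - a / w) * (w - b) = a + b * (1 - a / w) := by field_simp; ring
      rw [this]
      have := mul_le_of_le_one_right hb hl1
      linarith
    rw [e1, h0, sub_zero] at h1
    have := hmono e2
    linarith
  have hpow : ∀ k : ℕ, (0 : ℝ) < (1 / 2) ^ k := fun k => by positivity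
  have hpow1 : ∀ k : ℕ, ((1 : ℝ) / 2) ^ k ≤ 1 := fun k => pow_le_one₀ (by norm_num) (by norm_num)
  have htend : Filter.Tendsto (fun k : ℕ => ((1 : ℝ) / 2) ^ k) Filter.atTop (nhds 0) :=
    tendsto_pow_atTop_nhds_zero_of_lt_one (by norm_num) (by norm_num)
  have hscalek : ∀ (k : ℕ) t, 0 ≤ t → t ≤ δ → h ((1 / 2) ^ k * t) = (m / N) ^ k * h t := by
    intro k
    induction k with
    | zero => intro t _ _; simp
    | succ k ih =>
      intro t ht0 ht
      have h1 : (1 / 2 : ℝ) ^ k * t ≤ δ := le_trans (mul_le_of_le_one_left ht0 (hpow1 k)) ht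
      have h2 := hscale ((1 / 2) ^ (k + 1) * t) (by rw [pow_succ]; linarith)
      have e : 2 * ((1 / 2 : ℝ) ^ (k + 1) * t) = (1 / 2) ^ k * t := by rw [pow_succ]; ring
      rw [e, ih t ht0 ht] at h2
      have h3 : h ((1 / 2) ^ (k + 1) * t) = m * ((m / N) ^ k * h t) / N := by
        rw [eq_div_iff hNpos.ne', ← h2, mul_comm]
      rw [h3, pow_succ (m / N)]
      ring
  -- half of the shifts vanish
  have hle : m / N ≤ 1 / 2 := by
    -- `hshift` with b = a almost doubles h from a to 2a when a is small, while `hscale` makes the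
    -- quotient h a / h (2a) equal to m / N.
    have key : ∀ k : ℕ, m / N * (1 + (1 - (1 / 2) ^ k * (δ / 2 / w)) ^ n) ≤ 1 := by
      intro k
      set a := (1 / 2 : ℝ) ^ k * (δ / 2) with ha
      have ha0 : 0 < a := by positivity
      have haδ : a ≤ δ / 2 := mul_le_of_le_one_left (by positivity) (hpow1 k)
      have h1 := hshift a a ha0.le (by linarith) ha0.le
      have h2 := hscale a (by linarith)
      have h3 := hpos (2 * a) (by linarith)
      have e : (1 / 2 : ℝ) ^ k * (δ / 2 / w) = a / w := by rw [ha]; ring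
      have h4 : h a = m / N * h (2 * a) := by field_simp; linarith
      rw [← two_mul, h4] at h1
      rw [e]
      by_contra! hlt
      have := mul_lt_mul_of_pos_right hlt h3
      linarith
    have hl : Filter.Tendsto (fun k : ℕ => m / N * (1 + (1 - (1 / 2 : ℝ) ^ k * (δ / 2 / w)) ^ n))
        Filter.atTop (nhds (m / N * (1 + (1 - 0 * (δ / 2 / w)) ^ n))) :=
      (((htend.mul_const _).const_sub _).pow n |>.const_add _).const_mul _
    have := le_of_tendsto' hl key
    simp only [zero_mul, sub_zero, one_pow] at this
    linarith
  -- Otherwise h would decay along δ / 2^k faster than linearly, against `hlow`.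
  have hge : 1 / 2 ≤ m / N := by
    by_contra! hlt
    have hmN0 : 0 ≤ m / N := by positivity
    have key : ∀ k : ℕ, c * δ ≤ (2 * (m / N)) ^ k * h δ := by
      intro k
      have h1 := hlow ((1 / 2) ^ k * δ) (by positivity)
        (le_trans (mul_le_of_le_one_left hδpos.le (hpow1 k)) hδw.le)
      rw [hscalek k δ hδpos.le le_rfl] at h1
      have h2 : (2 : ℝ) ^ k * (1 / 2) ^ k = 1 := by rw [← mul_pow]; norm_num
      calc c * δ = 2 ^ k * (c * ((1 / 2) ^ k * δ)) := by linear_combination (-c * δ) * h2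
        _ ≤ 2 ^ k * ((m / N) ^ k * h δ) := by gcongr
        _ = _ := by rw [mul_pow]; ring
    have hl : Filter.Tendsto (fun k : ℕ => (2 * (m / N)) ^ k * h δ) Filter.atTop
        (nhds (0 * h δ)) :=
      (tendsto_pow_atTop_nhds_zero_of_lt_one (by positivity) (by linarith)).mul_const _
    have h3 := ge_of_tendsto' hl key
    have : 0 < c * δ := by positivity
    linarith
  have hhalf : m / N = 1 / 2 := le_antisymm hle hge
  rw [hhalf] at hscalek
  -- Scaling a and b down by 2^k is exact for h on [0, δ] and sends the loss factor in `hshift` to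
  -- 1.
  have hsuper : ∀ a b, 0 ≤ a → 0 ≤ b → a + b ≤ δ → h a + h b ≤ h (a + b) := by
    intro a b ha hb hab
    have key : ∀ k : ℕ, h a + (1 - (1 / 2) ^ k * (a / w)) ^ n * h b ≤ h (a + b) := by
      intro k
      have ha1 : (1 / 2 : ℝ) ^ k * a ≤ a := mul_le_of_le_one_left ha (hpow1 k)
      have h1 := hshift ((1 / 2) ^ k * a) ((1 / 2) ^ k * b) (by positivity)
        (by linarith) (by positivity)
      rw [← mul_add, hscalek k a ha (by linarith), hscalek k b hb (by linarith),
        hscalek k (a + b) (by positivity) hab, mul_div_assoc] at h1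
      refine le_of_mul_le_mul_left ?_ (hpow k)
      linarith
    have hl : Filter.Tendsto (fun k : ℕ => h a + (1 - (1 / 2 : ℝ) ^ k * (a / w)) ^ n * h b)
        Filter.atTop (nhds (h a + (1 - 0 * (a / w)) ^ n * h b)) :=
      ((((htend.mul_const _).const_sub _).pow n).mul_const _).const_add _
    simpa using le_of_tendsto' hl key
  have hmul : ∀ (j : ℕ) t, 0 ≤ t → j * t ≤ δ → j * h t ≤ h (j * t) := by
    intro j t ht
    induction j with
    | zero => intro _; simp [h0]
    | succ j ih =>
      intro hj
      push_cast at hj ⊢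
      have h1 := ih (by linarith)
      have h2 := hsuper (j * t) t (by positivity) ht (by linarith)
      rw [add_mul, add_mul, one_mul, one_mul]
      linarith
  -- the increments would jump at the smallest positive shift
  have key : ∀ k : ℕ, ((w - δ) / (w - δ + (1 / 2) ^ k * δ)) ^ n ≤ 1 - 2 / N := by
    intro k
    set ε := (1 / 2 : ℝ) ^ k * δ with hε
    have hε0 : 0 < ε := by positivity
    have hεδ : ε ≤ δ := mul_le_of_le_one_left hδpos.le (hpow1 k)
    -- The ratio for which the homothety centred at w moves δ - ε to δ. It tends to 1 with ε → 0
    -- because δ < w.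
    set l := (w - δ) / (w - δ + ε) with hl
    have hden : 0 < w - δ + ε := by linarith
    have hl0 : 0 < l := div_pos (by linarith) hden
    have hl1 : l ≤ 1 := (div_le_one hden).2 (by linarith)
    have h1 := hhom l (δ - ε) δ hl0 hl1 (by linarith)
    have e1 : w - l * (w - (δ - ε)) = δ := by rw [hl]; field_simp; ring
    have e2 : w - l * (w - δ) ≤ δ + ε := by
      have : l * (w - δ + ε) = w - δ := by rw [hl]; field_simp
      nlinarith
    rw [e1] at h1
    have h2 := hmono e2
    have h3 : h ((δ + ε) / 2) ≤ h δ - h (δ - ε) / 2 := by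
      have e := hsuper ((δ + ε) / 2) ((δ - ε) / 2) (by linarith) (by linarith) (by linarith)
      have e3 := hscalek 1 (δ - ε) (by linarith) (by linarith)
      have e4 : (1 / 2 : ℝ) ^ 1 * (δ - ε) = (δ - ε) / 2 := by ring
      have e5 : (δ + ε) / 2 + (δ - ε) / 2 = δ := by ring
      rw [e4] at e3
      rw [e5, e3] at e
      linarith
    -- The shift δ itself starts to contribute here, adding h ε to the m unshifted terms.
    have h4 : m * h (δ + ε) + h ε ≤ N * h ((δ + ε) / 2) := by
      rw [hsplit]
      have e3 : 2 * ((δ + ε) / 2) = δ + ε := by ring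
      rw [e3]
      have e4 := Finset.single_le_sum (f := fun x => h (δ + ε - d x))
        (fun x _ => hnonneg _) hz
      have e5 : δ + ε - d z = ε := by rw [← hδ]; ring
      simp only [e5] at e4
      linarith
    have h5 : h δ - h (δ - ε) ≤ h ε := by
      have e3 := hmul (2 ^ k - 1) ε hε0.le ?_
      · have e4 := hscalek k δ hδpos.le le_rfl
        rw [← hε] at e4
        have e5 : ((2 ^ k - 1 : ℕ) : ℝ) = 2 ^ k - 1 := by
          rw [Nat.cast_sub Nat.one_le_two_pow]; simp
        have e6 : (2 : ℝ) ^ k * (1 / 2) ^ k = 1 := by rw [← mul_pow]; norm_num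
        have e7 : (2 ^ k - 1) * ε = δ - ε := by rw [hε]; linear_combination δ * e6
        rw [e5, e7] at e3
        have e8 : 2 ^ k * h ε = h δ := by rw [e4]; linear_combination h δ * e6
        linarith
      · have e5 : ((2 ^ k - 1 : ℕ) : ℝ) = 2 ^ k - 1 := by
          rw [Nat.cast_sub Nat.one_le_two_pow]; simp
        have e6 : (2 : ℝ) ^ k * (1 / 2) ^ k = 1 := by rw [← mul_pow]; norm_num
        have e7 : (2 ^ k - 1) * ε = δ - ε := by rw [hε]; linear_combination δ * e6
        rw [e5, e7]; linarith
    have hm2 : m = N / 2 := by field_simp at hhalf; linarith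
    have hhε := hpos ε hε0
    have h6 : h (δ + ε) + 2 / N * h ε ≤ 2 * h ((δ + ε) / 2) := by
      rw [hm2] at h4
      have : N * (h (δ + ε) + 2 / N * h ε) ≤ N * (2 * h ((δ + ε) / 2)) := by
        have : N * (h (δ + ε) + 2 / N * h ε) = 2 * (N / 2 * h (δ + ε) + h ε) := by
          field_simp
        rw [this]; linarith
      exact le_of_mul_le_mul_left this hNpos
    -- The increment of h after δ falls short of the one before δ by at least 2 / N * h ε, but the
    -- homothety allows a loss of at most the factor l ^ n.
    have h7 : 2 / N * h ε ≤ (1 - l ^ n) * (h δ - h (δ - ε)) := by linarith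
    have h8 : (1 - l ^ n) * (h δ - h (δ - ε)) ≤ (1 - l ^ n) * h ε :=
      mul_le_mul_of_nonneg_left h5 (sub_nonneg.2 (pow_le_one₀ hl0.le hl1))
    have := le_of_mul_le_mul_right (h7.trans h8) hhε
    linarith
  have hl : Filter.Tendsto (fun k : ℕ => ((w - δ) / (w - δ + (1 / 2 : ℝ) ^ k * δ)) ^ n)
      Filter.atTop (nhds (((w - δ) / (w - δ + 0 * δ)) ^ n)) := by
    refine (tendsto_const_nhds.div ((htend.mul_const _).const_add _) ?_).pow n
    linarith
  have h1 := le_of_tendsto' hl key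
  rw [zero_mul, add_zero, div_self (by linarith), one_pow] at h1
  have : 0 < 2 / N := by positivity
  linarith

/-- Any two distinct points of `S` lie on distinct parallel support hyperplanes of `S`. -/
def IsAntipodalSet {V : Type*} [AddCommGroup V] [Module ℝ V] (S : Set V) : Prop :=
  ∀ x ∈ S, ∀ y ∈ S, x ≠ y → ∃ f : V →ₗ[ℝ] ℝ, f y < f x ∧ ∀ z ∈ S, f y ≤ f z ∧ f z ≤ f x

/-! ### Volume argument for antipodal sets -/

section Measure

variable {V : Type*} [NormedAddCommGroup V] [NormedSpace ℝ V]

theorem AffineMap.map_homothety_half (d : V →ᵃ[ℝ] ℝ) (x u : V) :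
    d (homothety x (1 / 2 : ℝ) u) = (d x + d u) / 2 := by
  rw [homothety_eq_lineMap, d.apply_lineMap, lineMap_apply_module]
  simp only [smul_eq_mul]; ring

theorem Convex.image_homothety_subset {P : Set V} (hP : Convex ℝ P) {x : V} (hx : x ∈ P) {l : ℝ}
    (h0 : 0 ≤ l) (h1 : l ≤ 1) : homothety x l '' P ⊆ P := by
  rintro _ ⟨u, hu, rfl⟩
  rw [homothety_eq_lineMap]
  exact hP.lineMap_mem hx hu ⟨h0, h1⟩

theorem LinearMap.bounds_convexHull (f : V →ₗ[ℝ] ℝ) {S : Set V} {a b : ℝ}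
    (h : ∀ z ∈ S, a ≤ f z ∧ f z ≤ b) : ∀ u ∈ convexHull ℝ S, a ≤ f u ∧ f u ≤ b := by
  have : convexHull ℝ S ⊆ f ⁻¹' Set.Icc a b :=
    convexHull_min (fun z hz => h z hz) ((convex_Icc a b).linear_preimage f)
  exact fun u hu => this hu

theorem AffineMap.bounds_convexHull (f : V →ᵃ[ℝ] ℝ) {S : Set V} {a b : ℝ}
    (h : ∀ z ∈ S, a ≤ f z ∧ f z ≤ b) : ∀ u ∈ convexHull ℝ S, a ≤ f u ∧ f u ≤ b := by
  have : convexHull ℝ S ⊆ f ⁻¹' Set.Icc a b :=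
    convexHull_min (fun z hz => h z hz) ((convex_Icc a b).affine_preimage f)
  exact fun u hu => this hu

theorem isCompact_convexHull_finset (S : Finset V) : IsCompact (convexHull ℝ (S : Set V)) :=
  S.finite_toSet.isCompact_convexHull ℝ

theorem biUnion_homothety_subset {S : Finset V} (B : Set V) :
    (⋃ x ∈ S, homothety x (1 / 2 : ℝ) '' convexHull ℝ (S : Set V) ∩ B) ⊆
      convexHull ℝ (S : Set V) ∩ B :=
  Set.iUnion₂_subset fun x hx => Set.inter_subset_inter_left _
    ((convex_convexHull ℝ _).image_homothety_subset (subset_convexHull ℝ _ hx)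
      (by norm_num) (by norm_num))

variable [FiniteDimensional ℝ V] [MeasurableSpace V] [BorelSpace V] (μ : Measure V) [μ.IsAddHaarMeasure]

theorem MeasureTheory.Measure.addHaar_affine_level {f : V →ₗ[ℝ] ℝ} (hf : f ≠ 0) (k : ℝ) :
    μ {u | f u = k} = 0 := by
  let A : AffineSubspace ℝ V := (AffineSubspace.mk' k (⊥ : Submodule ℝ ℝ)).comap f.toAffineMap
  have hA : (A : Set V) = {u | f u = k} := by
    ext u
    simp [A, AffineSubspace.mem_mk', sub_eq_zero]
  rw [← hA]
  refine Measure.addHaar_affineSubspace μ A fun htop => hf ?_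
  have h : ∀ u, f u = k := fun u => by
    have : u ∈ (A : Set V) := by rw [htop]; trivial
    rwa [hA] at this
  ext u
  rw [h u, ← h 0, map_zero]; rfl

/-- The separating f is at least its mean value (f x + f y) / 2 on the copy at x and at most that on
the copy at y, so the copies meet inside one hyperplane. -/
theorem IsAntipodalSet.aedisjoint_homothety {S : Set V} (hS : IsAntipodalSet S) :
    S.Pairwise fun x y => AEDisjoint μ (homothety x (1 / 2 : ℝ) '' convexHull ℝ S)
      (homothety y (1 / 2 : ℝ) '' convexHull ℝ S) := by
  intro x hx y hy hxy
  obtain ⟨f, hlt, hf⟩ := hS x hx y hy hxy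
  have hf0 : f ≠ 0 := by rintro rfl; simp at hlt
  refine measure_mono_null ?_ (Measure.addHaar_affine_level μ hf0 ((f x + f y) / 2))
  rintro _ ⟨⟨u, hu, rfl⟩, ⟨v, hv, huv⟩⟩
  have h1 := f.toAffineMap.map_homothety_half x u
  have h2 := f.toAffineMap.map_homothety_half y v
  rw [huv] at h2
  have hu' := (f.bounds_convexHull hf u hu).1
  have hv' := (f.bounds_convexHull hf v hv).2
  simp only [LinearMap.coe_toAffineMap] at h1 h2
  simp only [Set.mem_ofPred_eq]
  linarith

variable {S : Finset V}

theorem measurableSet_image_homothety (x : V) {P : Set V} (hP : IsCompact P) :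
    MeasurableSet (homothety x (1 / 2 : ℝ) '' P) :=
  (hP.image (homothety x (1 / 2 : ℝ)).continuous_of_finiteDimensional).measurableSet

theorem real_image_homothety (x : V) {l : ℝ} (hl : 0 ≤ l) (P : Set V) :
    μ.real (homothety x l '' P) = l ^ finrank ℝ V * μ.real P := by
  rw [Measure.real, Measure.addHaar_image_homothety, ENNReal.toReal_mul,
    ENNReal.toReal_ofReal (abs_nonneg _), abs_of_nonneg (pow_nonneg hl _), Measure.real]

theorem IsAntipodalSet.real_biUnion (hS : IsAntipodalSet (S : Set V)) {B : Set V}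
    (hB : MeasurableSet B) :
    μ.real (⋃ x ∈ S, homothety x (1 / 2 : ℝ) '' convexHull ℝ (S : Set V) ∩ B) =
      ∑ x ∈ S, μ.real (homothety x (1 / 2 : ℝ) '' convexHull ℝ (S : Set V) ∩ B) := by
  have hc := isCompact_convexHull_finset S
  refine measureReal_biUnion_finset₀ ?_ ?_ ?_
  · exact fun x hx y hy hxy => (hS.aedisjoint_homothety μ hx hy hxy).mono
      Set.inter_subset_left Set.inter_subset_left
  · exact fun x _ => ((measurableSet_image_homothety x hc).inter hB).nullMeasurableSet
  · intro x _
    refine measure_ne_top_of_subset Set.inter_subset_left ?_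
    exact (hc.image (homothety x (1 / 2 : ℝ)).continuous_of_finiteDimensional).measure_lt_top.ne

theorem real_convexHull_pos (h : affineSpan ℝ (S : Set V) = ⊤) :
    0 < μ.real (convexHull ℝ (S : Set V)) := by
  refine ENNReal.toReal_pos ?_ (isCompact_convexHull_finset S).measure_lt_top.ne
  exact (Measure.measure_pos_of_nonempty_interior μ
    (interior_convexHull_nonempty_iff_affineSpan_eq_top.2 h)).ne'

/-- Danzer–Grünbaum bound for sets spanning the whole space. -/
theorem IsAntipodalSet.card_le_of_affineSpan_eq_top (hS : IsAntipodalSet (S : Set V))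
    (h : affineSpan ℝ (S : Set V) = ⊤) : S.card ≤ 2 ^ finrank ℝ V := by
  let μ : Measure V := Measure.addHaar
  have h1 := hS.real_biUnion μ MeasurableSet.univ
  have h2 := measureReal_mono (μ := μ) (biUnion_homothety_subset (S := S) Set.univ)
    (by rw [Set.inter_univ]; exact (isCompact_convexHull_finset S).measure_lt_top.ne)
  rw [h1] at h2
  simp only [Set.inter_univ, real_image_homothety μ _ (show (0 : ℝ) ≤ 1 / 2 by norm_num),
    Finset.sum_const, nsmul_eq_mul, ← mul_assoc] at h2
  have h3 : (S.card : ℝ) * (1 / 2) ^ finrank ℝ V ≤ 1 :=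
    le_of_mul_le_mul_right (by linarith) (real_convexHull_pos μ h)
  rw [one_div, inv_pow, ← div_eq_mul_inv, div_le_one (by positivity)] at h3
  exact_mod_cast h3

/-- The copies fit into P both inside B and inside its complement. With 2^n copies the two
inequalities add up to an equality, so each is one. -/
theorem IsAntipodalSet.real_inter_eq_sum (hS : IsAntipodalSet (S : Set V))
    (hcard : S.card = 2 ^ finrank ℝ V) {B : Set V} (hB : MeasurableSet B) :
    μ.real (convexHull ℝ (S : Set V) ∩ B) =
      ∑ x ∈ S, μ.real (homothety x (1 / 2 : ℝ) '' convexHull ℝ (S : Set V) ∩ B) := by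
  have hc := isCompact_convexHull_finset S
  have hfin : ∀ B, μ (convexHull ℝ (S : Set V) ∩ B) ≠ ∞ := fun B =>
    measure_ne_top_of_subset Set.inter_subset_left hc.measure_lt_top.ne
  have hle : ∀ {B}, MeasurableSet B →
      ∑ x ∈ S, μ.real (homothety x (1 / 2 : ℝ) '' convexHull ℝ (S : Set V) ∩ B) ≤
        μ.real (convexHull ℝ (S : Set V) ∩ B) := fun {B} hB => by
    rw [← hS.real_biUnion μ hB]
    exact measureReal_mono (biUnion_homothety_subset B) (hfin B)
  refine le_antisymm ?_ (hle hB)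
  have h1 := hle hB.compl
  have h2 : ∑ x ∈ S, μ.real (homothety x (1 / 2 : ℝ) '' convexHull ℝ (S : Set V)) =
      μ.real (convexHull ℝ (S : Set V)) := by
    simp only [real_image_homothety μ _ (show (0 : ℝ) ≤ 1 / 2 by norm_num),
      Finset.sum_const, nsmul_eq_mul, ← mul_assoc, hcard]
    push_cast
    rw [← mul_pow]; norm_num
  have h3 := measureReal_inter_add_sdiff (μ := μ) (s := convexHull ℝ (S : Set V)) hB
    hc.measure_lt_top.ne
  have h4 : ∀ x ∈ S, μ.real (homothety x (1 / 2 : ℝ) '' convexHull ℝ (S : Set V) ∩ B) +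
      μ.real (homothety x (1 / 2 : ℝ) '' convexHull ℝ (S : Set V) ∩ Bᶜ) =
      μ.real (homothety x (1 / 2 : ℝ) '' convexHull ℝ (S : Set V)) := fun x _ =>
    measureReal_inter_add_sdiff (μ := μ) hB
      (hc.image (homothety x (1 / 2 : ℝ)).continuous_of_finiteDimensional).measure_lt_top.ne
  rw [← Finset.sum_congr rfl h4, Finset.sum_add_distrib] at h2
  rw [Set.sdiff_eq] at h3
  linarith

/-- An affine function whose zero set in an extremal antipodal set spans a hyperplane takes only
its two extreme values on that set. -/
theorem IsAntipodalSet.eq_zero_or_eq_max (hS : IsAntipodalSet (S : Set V))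
    (hcard : S.card = 2 ^ finrank ℝ V) (d : V →ᵃ[ℝ] ℝ) (hd : ∀ x ∈ S, 0 ≤ d x)
    {y : V} (hy : y ∈ S) (hy0 : 0 < d y) (hmax : ∀ x ∈ S, d x ≤ d y)
    {F : Finset V} (hFS : F ⊆ S) (hFne : F.Nonempty) (hF : ∀ x ∈ F, d x = 0)
    (hspan : affineSpan ℝ (insert y (F : Set V)) = ⊤) :
    ∀ x ∈ S, d x = 0 ∨ d x = d y := by
  classical
  let μ : Measure V := Measure.addHaar
  set P := convexHull ℝ (S : Set V) with hP
  have hc : IsCompact P := isCompact_convexHull_finset S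
  have hconv : Convex ℝ P := convex_convexHull ℝ _
  have hyP : y ∈ P := subset_convexHull ℝ _ hy
  have hfin : ∀ B, μ (P ∩ B) ≠ ∞ := fun B =>
    measure_ne_top_of_subset Set.inter_subset_left hc.measure_lt_top.ne
  have hdc : Continuous d := d.continuous_of_finiteDimensional
  have hmeas : ∀ t, MeasurableSet {u | d u ≤ t} := fun t =>
    (isClosed_le hdc continuous_const).measurableSet
  have hdP : ∀ u ∈ P, 0 ≤ d u ∧ d u ≤ d y :=
    d.bounds_convexHull fun z hz => ⟨hd z hz, hmax z hz⟩
  set h : ℝ → ℝ := fun t => μ.real (P ∩ {u | d u ≤ t}) with hh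
  have hdiff : ∀ a b, a ≤ b → h b - h a = μ.real (P ∩ {u | a < d u ∧ d u ≤ b}) := by
    intro a b hab
    have h1 := measureReal_inter_add_sdiff (μ := μ) (s := P ∩ {u | d u ≤ b}) (hmeas a) (hfin _)
    have e1 : P ∩ {u | d u ≤ b} ∩ {u | d u ≤ a} = P ∩ {u | d u ≤ a} := by
      ext u; simp only [Set.mem_inter_iff, Set.mem_ofPred_eq]
      exact ⟨fun h => ⟨h.1.1, h.2⟩, fun h => ⟨⟨h.1, h.2.trans hab⟩, h.2⟩⟩
    have e2 : (P ∩ {u | d u ≤ b}) \ {u | d u ≤ a} = P ∩ {u | a < d u ∧ d u ≤ b} := by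
      ext u; simp only [Set.mem_inter_iff, Set.mem_sdiff, Set.mem_ofPred_eq, not_le]
      tauto
    rw [e1, e2] at h1
    simp only [hh]
    linarith
  have hdl : ∀ (l : ℝ) u, d (homothety y l u) = d y - l * (d y - d u) := by
    intro l u
    rw [homothety_eq_lineMap, d.apply_lineMap, lineMap_apply_module]
    simp only [smul_eq_mul]; ring
  refine shift_eq_zero_or_eq_max_of_selfSimilar S d (finrank ℝ V) h (d y) hy0 hcard hd hmax
    ?_ ?_ ?_ ?_ ?_
  · intro t ht
    have : P ∩ {u | d u ≤ t} = ∅ := by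
      ext u
      simp only [Set.mem_inter_iff, Set.mem_ofPred_eq, Set.mem_empty_iff_false, iff_false, not_and,
        not_le]
      exact fun hu => ht.trans_le (hdP u hu).1
    simp [hh, this]
  · intro a b hab
    exact measureReal_mono (Set.inter_subset_inter_right _ fun u (hu : d u ≤ a) => hu.trans hab)
      (hfin _)
  · intro t
    simp only [hh]
    rw [hS.real_inter_eq_sum μ hcard (hmeas t), Finset.mul_sum]
    refine Finset.sum_congr rfl fun x _ => ?_
    have : homothety x (1 / 2 : ℝ) '' P ∩ {u | d u ≤ t} =
        homothety x (1 / 2 : ℝ) '' (P ∩ {u | d u ≤ 2 * t - d x}) := by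
      ext v
      constructor
      · rintro ⟨⟨u, hu, rfl⟩, hv⟩
        refine ⟨u, ⟨hu, ?_⟩, rfl⟩
        simp only [Set.mem_ofPred_eq, d.map_homothety_half] at hv ⊢
        linarith
      · rintro ⟨u, ⟨hu, hv⟩, rfl⟩
        refine ⟨⟨u, hu, rfl⟩, ?_⟩
        simp only [Set.mem_ofPred_eq, d.map_homothety_half] at hv ⊢
        linarith
    rw [← hP, this, real_image_homothety μ _ (by norm_num), ← mul_assoc, ← mul_pow]
    norm_num
  -- Convexity of P and y ∈ P: the homothety centred at y maps the slab of P between levels a and b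
  -- into another slab of P.
  · intro l a b hl0 hl1 hab
    rw [hdiff a b hab, hdiff _ _ (by nlinarith), ← real_image_homothety μ y hl0.le]
    refine measureReal_mono ?_ (hfin _)
    rintro _ ⟨u, ⟨hu, hau, hub⟩, rfl⟩
    refine ⟨hconv.image_homothety_subset hyP hl0.le hl1 ⟨u, hu, rfl⟩, ?_⟩
    simp only [Set.mem_ofPred_eq, hdl]
    constructor <;> nlinarith
  -- T is a pyramid with apex y over F, where d vanishes. Its part above level t lies in the copy of
  -- T with ratio 1 - t / d y at the apex, so the part below has volume at least proportional to t.
  · set T := convexHull ℝ (insert y (F : Set V)) with hT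
    have hTP : T ⊆ P := convexHull_mono (Set.insert_subset hy (by exact_mod_cast hFS))
    have hTeq : (T : Set V) = convexHull ℝ ((insert y F : Finset V) : Set V) := by
      rw [hT, Finset.coe_insert]
    have hTc : IsCompact T := hTeq ▸ isCompact_convexHull_finset _
    have hTpos : 0 < μ.real T := by
      rw [hTeq]; exact real_convexHull_pos μ (by rw [Finset.coe_insert]; exact hspan)
    -- Positive dimension is what allows (1 - t / d y) ^ n to be bounded by 1 - t / d y.
    have hTn : 1 ≤ finrank ℝ V := by
      by_contra! h0
      have hz : finrank ℝ V = 0 := by omega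
      have := finrank_zero_iff.1 hz
      obtain ⟨x, hx⟩ := hFne
      rw [Subsingleton.elim y x, hF x hx] at hy0
      exact hy0.false
    refine ⟨μ.real T / d y, by positivity, fun t ht0 ht => ?_⟩
    have hsub : T ∩ {u | d u ≤ t}ᶜ ⊆ homothety y (1 - t / d y) '' T := by
      rintro u ⟨hu, hut⟩
      simp only [Set.mem_compl_iff, Set.mem_ofPred_eq, not_le] at hut
      rw [hT, convexHull_insert (by exact_mod_cast hFne), convexJoin_singleton_left] at hu
      simp only [Set.mem_iUnion] at hu
      obtain ⟨v, hv, hu⟩ := hu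
      have hv0 : d v = 0 := by
        have := d.bounds_convexHull (S := (F : Set V)) (a := 0) (b := 0)
          (fun z hz => by simp [hF z hz]) v hv
        exact le_antisymm this.2 this.1
      rw [segment_eq_image_lineMap] at hu
      obtain ⟨s, ⟨hs0, hs1⟩, rfl⟩ := hu
      rw [d.apply_lineMap, lineMap_apply_module, hv0] at hut
      simp only [smul_eq_mul, mul_zero, add_zero] at hut
      have htd : t / d y < 1 - s := (div_lt_iff₀ hy0).2 hut
      have hvT : v ∈ T := convexHull_mono (Set.subset_insert _ _) hv
      have hyT : y ∈ T := subset_convexHull ℝ _ (Set.mem_insert _ _)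
      have hq : 0 ≤ t / d y := by positivity
      rcases eq_or_lt_of_le hs0 with rfl | hs0
      · refine ⟨y, hyT, ?_⟩
        simp
      · refine ⟨lineMap y v (s / (1 - t / d y)), ?_, ?_⟩
        · refine (convex_convexHull ℝ _).lineMap_mem hyT hvT ⟨?_, ?_⟩
          · exact div_nonneg hs0.le (by linarith)
          · rw [div_le_one (by linarith)]; linarith
        · rw [homothety_eq_lineMap, lineMap_lineMap_right]
          congr 1
          exact mul_div_cancel₀ s (by linarith : 1 - t / d y ≠ 0)
    have h1 := measureReal_inter_add_sdiff (μ := μ) (s := T) (hmeas t) hTc.measure_lt_top.ne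
    have hl0 : 0 ≤ 1 - t / d y := by rw [sub_nonneg, div_le_one hy0]; exact ht
    have hl1 : 1 - t / d y ≤ 1 := by
      have : 0 ≤ t / d y := by positivity
      linarith
    have h2 : μ.real (T \ {u | d u ≤ t}) ≤ (1 - t / d y) * μ.real T := by
      rw [Set.sdiff_eq]
      refine (measureReal_mono hsub ?_).trans ?_
      · exact (hTc.image
          (homothety y (1 - t / d y)).continuous_of_finiteDimensional).measure_lt_top.ne
      · rw [real_image_homothety μ y hl0]
        gcongr
        exact pow_le_of_le_one hl0 hl1 (by omega)
    have h3 : μ.real (T ∩ {u | d u ≤ t}) ≤ h t :=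
      measureReal_mono (Set.inter_subset_inter_left _ hTP) (hfin _)
    have h4 : μ.real T / d y * t = μ.real T - (1 - t / d y) * μ.real T := by field_simp; ring
    rw [h4]; linarith

end Measure

/-! ### Facets and the parallelotope structure of extremal sets -/

section Structure

variable {V : Type*} [NormedAddCommGroup V] [NormedSpace ℝ V] {S : Finset V} {c : V}

theorem IsAntipodalSet.mono {S T : Set V} (hT : IsAntipodalSet T) (h : S ⊆ T) :
    IsAntipodalSet S := fun x hx y hy hxy => by
  obtain ⟨f, hlt, hf⟩ := hT x (h hx) y (h hy) hxy
  exact ⟨f, hlt, fun z hz => hf z (h hz)⟩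

/-- The polar of `S` with respect to the centre `c`. -/
def polarAt (S : Finset V) (c : V) : Set (StrongDual ℝ V) := {f | ∀ x ∈ S, f (x - c) ≤ 1}

theorem convex_polarAt : Convex ℝ (polarAt S c) := by
  intro f hf g hg a b ha hb hab x hx
  have h1 := mul_le_mul_of_nonneg_left (hf x hx) ha
  have h2 := mul_le_mul_of_nonneg_left (hg x hx) hb
  simp only [_root_.add_apply, _root_.smul_apply, smul_eq_mul]
  linarith

theorem isClosed_polarAt : IsClosed (polarAt S c) := by
  have : polarAt S c = ⋂ x ∈ S, {f : StrongDual ℝ V | f (x - c) ≤ 1} := by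
    ext f; simp [polarAt]
  rw [this]
  exact isClosed_biInter fun x _ =>
    isClosed_le (ContinuousLinearMap.apply ℝ ℝ (x - c)).continuous continuous_const

theorem le_one_of_mem_polarAt {f : StrongDual ℝ V} (hf : f ∈ polarAt S c) {u : V}
    (hu : u ∈ convexHull ℝ (S : Set V)) : f (u - c) ≤ 1 := by
  have : convexHull ℝ (S : Set V) ⊆ {u | f u ≤ 1 + f c} :=
    convexHull_min (fun x hx => by
      have := hf x hx
      rw [map_sub] at this
      simp only [Set.mem_ofPred_eq]; linarith) (convex_halfSpace_le f.toLinearMap.isLinear _)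
  have := this hu
  rw [map_sub]
  simp only [Set.mem_ofPred_eq] at this
  linarith

variable [FiniteDimensional ℝ V]

/-- Translation moves S into its direction space, where it spans and the volume bound applies. This
sharper form forces an extremal set to span the whole space. -/
theorem IsAntipodalSet.card_le_vectorSpan (hS : IsAntipodalSet (S : Set V)) :
    S.card ≤ 2 ^ finrank ℝ (vectorSpan ℝ (S : Set V)) := by
  classical
  rcases S.eq_empty_or_nonempty with rfl | ⟨x₀, hx₀⟩
  · simp
  set W := vectorSpan ℝ (S : Set V) with hW
  let φ : W →ᵃ[ℝ] V := W.subtype.toAffineMap + AffineMap.const ℝ W x₀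
  have hφ : ∀ w : W, φ w = (w : V) + x₀ := fun w => by simp [φ]
  have hφinj : Function.Injective φ := fun a b h => by
    rw [hφ, hφ] at h
    exact Subtype.ext (add_right_cancel h)
  let S' : Finset W := S.preimage φ hφinj.injOn
  have himg : φ '' (S' : Set W) = S := by
    rw [Finset.coe_preimage, Set.image_preimage_eq_iff]
    intro x hx
    exact ⟨⟨x - x₀, vsub_mem_vectorSpan ℝ hx hx₀⟩, by simp [hφ]⟩
  have hcard : S'.card = S.card := by
    rw [← Finset.card_image_of_injective S' hφinj]
    congr 1
    exact_mod_cast himg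
  have hanti : IsAntipodalSet (S' : Set W) := by
    intro x hx y hy hxy
    have hmem : ∀ z ∈ (S' : Set W), φ z ∈ (S : Set V) := fun z hz => himg ▸ Set.mem_image_of_mem φ hz
    obtain ⟨f, hlt, hf⟩ := hS (φ x) (hmem x hx) (φ y) (hmem y hy) (hφinj.ne hxy)
    simp only [hφ, map_add, add_lt_add_iff_right] at hlt
    refine ⟨f ∘ₗ W.subtype, hlt, fun z hz => ?_⟩
    have := hf (φ z) (hmem z hz)
    simp only [hφ, map_add, add_le_add_iff_right] at this
    exact this
  have hne : (S' : Set W).Nonempty := by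
    rw [← Set.image_nonempty (f := φ), himg]; exact ⟨x₀, hx₀⟩
  have hspan : affineSpan ℝ (S' : Set W) = ⊤ := by
    rw [AffineSubspace.affineSpan_eq_top_iff_vectorSpan_eq_top_of_nonempty _ _ _ hne]
    have h1 := φ.map_vectorSpan (s := (S' : Set W))
    have hlin : φ.linear = W.subtype := by ext; simp [φ]
    rw [himg, ← hW, hlin] at h1
    refine Submodule.map_injective_of_injective W.injective_subtype ?_
    rw [h1, Submodule.map_top, Submodule.range_subtype]
  let _ : MeasurableSpace W := borel W
  have _ : BorelSpace W := ⟨rfl⟩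
  rw [← hcard]
  exact hanti.card_le_of_affineSpan_eq_top hspan

theorem IsAntipodalSet.card_le (hS : IsAntipodalSet (S : Set V)) :
    S.card ≤ 2 ^ finrank ℝ V :=
  hS.card_le_vectorSpan.trans (Nat.pow_le_pow_right (by norm_num) (Submodule.finrank_le _))

theorem IsAntipodalSet.affineSpan_eq_top (hS : IsAntipodalSet (S : Set V))
    (hcard : S.card = 2 ^ finrank ℝ V) : affineSpan ℝ (S : Set V) = ⊤ := by
  have hne : (S : Set V).Nonempty := by
    rw [Finset.coe_nonempty, ← Finset.card_pos, hcard]; positivity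
  rw [AffineSubspace.affineSpan_eq_top_iff_vectorSpan_eq_top_of_nonempty _ _ _ hne]
  refine Submodule.eq_top_of_finrank_eq (le_antisymm (Submodule.finrank_le _) ?_)
  exact (Nat.pow_le_pow_iff_right (by norm_num)).1 (hcard ▸ hS.card_le_vectorSpan)

theorem isCompact_polarAt (hc : c ∈ interior (convexHull ℝ (S : Set V))) :
    IsCompact (polarAt S c) := by
  obtain ⟨r, hr, hball⟩ := Metric.mem_nhds_iff.1 (mem_interior_iff_mem_nhds.1 hc)
  refine Metric.isCompact_of_isClosed_isBounded isClosed_polarAt ?_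
  refine (Metric.isBounded_closedBall (x := 0) (r := 1 / (r / 2))).subset fun f hf => ?_
  rw [mem_closedBall_zero_iff]
  refine ContinuousLinearMap.opNorm_bound_of_ball_bound (half_pos hr) 1 f fun z hz => ?_
  rw [mem_closedBall_zero_iff] at hz
  have h1 := le_one_of_mem_polarAt hf (hball (show c + z ∈ Metric.ball c r by
    rw [mem_ball_iff_norm, add_sub_cancel_left]; linarith))
  have h2 := le_one_of_mem_polarAt hf (hball (show c - z ∈ Metric.ball c r by
    rw [mem_ball_iff_norm, sub_sub_cancel_left, norm_neg]; linarith))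
  rw [add_sub_cancel_left] at h1
  rw [sub_sub_cancel_left, map_neg] at h2
  rw [Real.norm_eq_abs, abs_le]
  exact ⟨by linarith, h1⟩

/-- By Krein–Milman the polar lies in the closed span of its extreme points, and it is a
neighbourhood of 0. -/
theorem span_extremePoints_polarAt (hc : c ∈ interior (convexHull ℝ (S : Set V))) :
    Submodule.span ℝ ((polarAt S c).extremePoints ℝ) = ⊤ := by
  set E := Submodule.span ℝ ((polarAt S c).extremePoints ℝ) with hE
  have hsub : polarAt S c ⊆ E := by
    rw [← closure_convexHull_extremePoints (isCompact_polarAt hc) convex_polarAt]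
    exact closure_minimal (convexHull_min Submodule.subset_span E.convex)
      E.closed_of_finiteDimensional
  refine E.eq_top_of_nonempty_interior' ⟨0, ?_⟩
  rw [mem_interior_iff_mem_nhds]
  refine Filter.mem_of_superset ?_ hsub
  have : ∀ᶠ f : StrongDual ℝ V in nhds 0, ∀ x ∈ S, f (x - c) ≤ 1 := by
    rw [Filter.eventually_all_finset]
    intro x _
    have h := (ContinuousLinearMap.apply ℝ ℝ (x - c)).continuous.tendsto (0 : StrongDual ℝ V)
    simp only [ContinuousLinearMap.apply_apply, _root_.zero_apply] at h
    exact (h.eventually (gt_mem_nhds zero_lt_one)).mono fun f hf => le_of_lt hf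
  exact this

/-- If some G ≠ 0 vanished on all tight vectors, then f ± t G would stay in the polar for small t >
0, and f would be their midpoint. -/
theorem span_tight_of_mem_extremePoints_polarAt {f : StrongDual ℝ V}
    (hf : f ∈ (polarAt S c).extremePoints ℝ) :
    Submodule.span ℝ {u | ∃ x ∈ S, f (x - c) = 1 ∧ x - c = u} = ⊤ := by
  by_contra hne
  obtain ⟨g, hg0, hg⟩ := Submodule.exists_le_ker_of_lt_top _ (lt_top_iff_ne_top.2 hne)
  set G := LinearMap.toContinuousLinearMap g with hG
  have hGx : ∀ x ∈ S, f (x - c) = 1 → G (x - c) = 0 := fun x hx hfx =>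
    hg (Submodule.subset_span ⟨x, hx, hfx, rfl⟩)
  have hev : ∀ᶠ t : ℝ in nhdsWithin 0 (Set.Ioi 0), ∀ x ∈ S,
      f (x - c) + t * G (x - c) ≤ 1 ∧ f (x - c) - t * G (x - c) ≤ 1 := by
    rw [Filter.eventually_all_finset]
    intro x hx
    rcases eq_or_lt_of_le (hf.1 x hx) with h1 | h1
    · rw [hGx x hx h1, h1]; simp
    · refine Filter.Eventually.filter_mono nhdsWithin_le_nhds ?_
      have ha : Filter.Tendsto (fun t : ℝ => f (x - c) + t * G (x - c)) (nhds 0)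
          (nhds (f (x - c))) := by
        have : Continuous (fun t : ℝ => f (x - c) + t * G (x - c)) := by fun_prop
        simpa using this.tendsto 0
      have hb : Filter.Tendsto (fun t : ℝ => f (x - c) - t * G (x - c)) (nhds 0)
          (nhds (f (x - c))) := by
        have : Continuous (fun t : ℝ => f (x - c) - t * G (x - c)) := by fun_prop
        simpa using this.tendsto 0
      filter_upwards [ha.eventually (gt_mem_nhds h1), hb.eventually (gt_mem_nhds h1)] with t h2 h3
      exact ⟨h2.le, h3.le⟩
  obtain ⟨t, ht, ht0⟩ := (hev.and self_mem_nhdsWithin).exists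
  replace ht0 : 0 < t := ht0
  have h1 : f + t • G ∈ polarAt S c := fun x hx => by simpa using (ht x hx).1
  have h2 : f - t • G ∈ polarAt S c := fun x hx => by simpa using (ht x hx).2
  have h3 : f ∈ openSegment ℝ (f + t • G) (f - t • G) :=
    ⟨1 / 2, 1 / 2, by norm_num, by norm_num, by norm_num, by module⟩
  have h4 := hf.2 h1 h2 h3
  have h5 : t • G = 0 := by simpa using h4
  have h6 : G = 0 := (smul_eq_zero.1 h5).resolve_left ht0.ne'
  refine hg0 ?_
  ext u
  exact DFunLike.congr_fun h6 u

variable [Nontrivial V]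

/-- The rigidity result applied to d = 1 - f(· - c), which is nonnegative on S and vanishes on the
tight points. -/
theorem IsAntipodalSet.exists_two_values (hS : IsAntipodalSet (S : Set V))
    (hcard : S.card = 2 ^ finrank ℝ V) (hc : c ∈ interior (convexHull ℝ (S : Set V)))
    {f : StrongDual ℝ V} (hf : f ∈ (polarAt S c).extremePoints ℝ) :
    ∃ m : ℝ, m ≠ 1 ∧ ∀ x ∈ S, f (x - c) = 1 ∨ f (x - c) = m := by
  classical
  let _ : MeasurableSpace V := borel V
  have _ : BorelSpace V := ⟨rfl⟩
  have hne : S.Nonempty := by rw [← Finset.card_pos, hcard]; positivity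
  let d : V →ᵃ[ℝ] ℝ := AffineMap.const ℝ V (1 + f c) - f.toLinearMap.toAffineMap
  have hd : ∀ u, d u = 1 - f (u - c) := fun u => by simp [d]; ring
  obtain ⟨y, hy, hmax⟩ := S.exists_max_image d hne
  have hd0 : ∀ x ∈ S, 0 ≤ d x := fun x hx => by rw [hd]; linarith [hf.1 x hx]
  have hy0 : 0 < d y := by
    by_contra! hle
    have hcv := d.bounds_convexHull (S := (S : Set V)) (a := 0) (b := 0)
      (fun z hz => ⟨hd0 z hz, (hmax z hz).trans hle⟩) c (interior_subset hc)
    rw [hd, sub_self, map_zero] at hcv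
    linarith [hcv.2]
  have htight := span_tight_of_mem_extremePoints_polarAt hf
  set F := S.filter (fun x => f (x - c) = 1) with hF
  have hFne : F.Nonempty := by
    rw [Finset.nonempty_iff_ne_empty]
    intro hemp
    refine (bot_ne_top : (⊥ : Submodule ℝ V) ≠ ⊤) ?_
    rw [← htight, eq_comm, Submodule.span_eq_bot]
    rintro u ⟨x, hx, hfx, rfl⟩
    have : x ∈ F := Finset.mem_filter.2 ⟨hx, hfx⟩
    rw [hemp] at this
    simp at this
  -- A functional g constant on y and the tight points is a multiple of f, because the tight vectors
  -- span; as f (y - c) ≠ 1, the multiple is zero.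
  have hspan : affineSpan ℝ (insert y (F : Set V)) = ⊤ := by
    rw [AffineSubspace.affineSpan_eq_top_iff_vectorSpan_eq_top_of_nonempty _ _ _
      (Set.insert_nonempty _ _)]
    by_contra hne
    obtain ⟨g, hg0, hg⟩ := Submodule.exists_le_ker_of_lt_top _ (lt_top_iff_ne_top.2 hne)
    obtain ⟨x₀, hx₀⟩ := hFne
    have hfx₀ := (Finset.mem_filter.1 hx₀).2
    have hgx : ∀ x ∈ insert y (F : Set V), g x = g x₀ := fun x hx => by
      have := hg (vsub_mem_vectorSpan ℝ hx (Set.mem_insert_of_mem y hx₀))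
      rw [LinearMap.mem_ker, vsub_eq_sub, map_sub, sub_eq_zero] at this
      exact this
    have hgf : g = g (x₀ - c) • f.toLinearMap := by
      refine LinearMap.ext_on htight ?_
      rintro u ⟨x, hx, hfx, rfl⟩
      have := hgx x (Set.mem_insert_of_mem y (Finset.mem_filter.2 ⟨hx, hfx⟩))
      simp only [LinearMap.smul_apply, ContinuousLinearMap.coe_coe, hfx, smul_eq_mul, mul_one,
        map_sub g, this]
    have h1 : g (y - c) = g (x₀ - c) := by
      rw [map_sub, map_sub, hgx y (Set.mem_insert _ _)]
    have h2 : g (y - c) = g (x₀ - c) * f (y - c) := by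
      conv_lhs => rw [hgf]
      simp
    rw [hd] at hy0
    have h3 : g (x₀ - c) * (1 - f (y - c)) = 0 := by linarith
    have h4 := (mul_eq_zero.1 h3).resolve_right hy0.ne'
    rw [h4, zero_smul] at hgf
    exact hg0 hgf
  refine ⟨f (y - c), ?_, fun x hx => ?_⟩
  · rw [hd] at hy0; linarith
  · have := hS.eq_zero_or_eq_max hcard d hd0 hy hy0 hmax (Finset.filter_subset _ _) hFne
      (fun x hx => by rw [hd, (Finset.mem_filter.1 hx).2, sub_self]) hspan x hx
    rw [hd, hd] at this
    exact this.imp (fun h => by linarith) (fun h => by linarith)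

/-- An antipodal set of maximal cardinality contains the vertices of a parallelotope. -/
theorem IsAntipodalSet.exists_parallelotope (hS : IsAntipodalSet (S : Set V))
    (hcard : S.card = 2 ^ finrank ℝ V) :
    ∃ (b : V) (w : Fin (finrank ℝ V) → V), (∀ i, w i ≠ 0) ∧ ∀ T, b + ∑ i ∈ T, w i ∈ S := by
  classical
  obtain ⟨c, hc⟩ := interior_convexHull_nonempty_iff_affineSpan_eq_top.2
    (hS.affineSpan_eq_top hcard)
  have hfr : finrank ℝ (Submodule.span ℝ ((polarAt S c).extremePoints ℝ)) = finrank ℝ V := by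
    rw [span_extremePoints_polarAt hc, finrank_top,
      ← (LinearMap.toContinuousLinearMap (𝕜 := ℝ) (E := V) (F' := ℝ)).finrank_eq]
    exact Subspace.dual_finrank_eq
  obtain ⟨f, hf, hfspan, -⟩ := Submodule.exists_fun_fin_finrank_span_eq ℝ
    ((polarAt S c).extremePoints ℝ)
  replace hfspan := hfspan.trans (span_extremePoints_polarAt hc)
  revert f
  rw [hfr]
  intro f hf hfspan
  choose m hm1 hm using fun i => hS.exists_two_values hcard hc (hf i)
  let Φ : V →ₗ[ℝ] (Fin (finrank ℝ V) → ℝ) := LinearMap.pi fun i => (f i).toLinearMap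
  have hΦ : ∀ u i, Φ u i = f i u := fun u i => rfl
  have hΦinj : Function.Injective Φ := by
    rw [injective_iff_map_eq_zero]
    intro u hu
    have hall : ∀ g : StrongDual ℝ V, g u = 0 := by
      intro g
      have hg : g ∈ Submodule.span ℝ (Set.range f) := by rw [hfspan]; trivial
      induction hg using Submodule.span_induction with
      | mem g hg => obtain ⟨i, rfl⟩ := hg; exact congrFun hu i
      | zero => simp
      | add g₁ g₂ _ _ h₁ h₂ => simp [h₁, h₂]
      | smul a g _ h => simp [h]
    exact (Module.forall_dual_apply_eq_zero_iff ℝ u).1 fun φ =>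
      hall (LinearMap.toContinuousLinearMap φ)
  let e := LinearMap.linearEquivOfInjective Φ hΦinj (by simp)
  have he : ∀ u i, e u i = f i u := fun u i => rfl
  let ψ : V → Finset (Fin (finrank ℝ V)) := fun x =>
    Finset.univ.filter fun i => f i (x - c) = 1
  have hval : ∀ x ∈ S, ∀ i, f i (x - c) = m i + if i ∈ ψ x then 1 - m i else 0 := by
    intro x hx i
    simp only [ψ, Finset.mem_filter, Finset.mem_univ, true_and]
    split_ifs with h
    · rw [h]; ring
    · rw [(hm i x hx).resolve_left h, add_zero]
  have hψ : Set.InjOn ψ S := by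
    intro x hx y hy hxy
    refine sub_left_injective (hΦinj (funext fun i => ?_) : x - c = y - c)
    rw [hΦ, hΦ, hval x hx, hval y hy, hxy]
  -- An injection from 2^n points into the 2^n subsets of `Fin n` hits every subset.
  have hsurj : Set.SurjOn ψ S (Finset.univ : Finset (Finset (Fin (finrank ℝ V)))) :=
    Finset.surjOn_of_injOn_of_card_le ψ (fun _ _ => by simp) hψ (by simp [hcard])
  refine ⟨c + e.symm m, fun i => e.symm (Pi.single i (1 - m i)), fun i => ?_, fun T => ?_⟩
  · rw [Ne, LinearEquiv.map_eq_zero_iff, Pi.single_eq_zero_iff, sub_eq_zero]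
    exact (hm1 i).symm
  · obtain ⟨x, hx, rfl⟩ := hsurj (Finset.mem_coe.2 (Finset.mem_univ T))
    have : c + e.symm m + ∑ i ∈ ψ x, e.symm (Pi.single i (1 - m i)) = x := by
      rw [add_assoc, ← map_sum, ← map_add, ← eq_sub_iff_add_eq', LinearEquiv.symm_apply_eq]
      funext i
      rw [he, hval x hx, Pi.add_apply, Finset.sum_apply]
      simp [Pi.single_apply]
    rw [this]
    exact hx

end Structure

/-! ### Clarkson's inequality over the vertices of a parallelotope -/

section Clarkson

theorem Real.add_rpow_le_rpow_add_of_nonneg {a b s : ℝ} (ha : 0 ≤ a) (hb : 0 ≤ b) (hs : 1 ≤ s) :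
    a ^ s + b ^ s ≤ (a + b) ^ s := by
  lift a to NNReal using ha
  lift b to NNReal using hb
  exact_mod_cast NNReal.add_rpow_le_rpow_add a b hs

/-- Clarkson's inequality for real numbers. -/
theorem two_mul_abs_rpow_add_le {r : ℝ} (hr : 2 ≤ r) (a b : ℝ) :
    2 * (|a| ^ r + |b| ^ r) ≤ |a + b| ^ r + |a - b| ^ r := by
  have hs : 1 ≤ r / 2 := by linarith
  have hsq : ∀ t : ℝ, |t| ^ r = (t ^ 2) ^ (r / 2) := fun t => by
    rw [← sq_abs, ← Real.rpow_natCast_mul (abs_nonneg t)]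
    congr 1; push_cast; ring
  rw [hsq, hsq, hsq, hsq]
  -- With s = r / 2 ≥ 1, t ↦ t ^ s is superadditive and convex; the parallelogram identity links the
  -- two bounds.
  have h1 := Real.add_rpow_le_rpow_add_of_nonneg (sq_nonneg a) (sq_nonneg b) hs
  have h2 := (convexOn_rpow hs).2 (Set.mem_Ici.2 (sq_nonneg (a + b)))
    (Set.mem_Ici.2 (sq_nonneg (a - b))) (show (0 : ℝ) ≤ 1 / 2 by norm_num)
    (show (0 : ℝ) ≤ 1 / 2 by norm_num) (by norm_num)
  simp only [smul_eq_mul] at h2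
  have e : 1 / 2 * (a + b) ^ 2 + 1 / 2 * (a - b) ^ 2 = a ^ 2 + b ^ 2 := by ring
  rw [e] at h2
  linarith

/-- Induction on the edges: the faces without and with the edge w j have centres differing by w j,
and `hN` is applied at their midpoint with half that edge. -/
theorem sum_powerset_ge_of_clarkson {V ι : Type*} [AddCommGroup V] [Module ℝ V] [DecidableEq ι]
    {N : V → ℝ} (hN : ∀ x h, 2 * (N x + N h) ≤ N (x + h) + N (x - h)) (w : ι → V)
    (I : Finset ι) (b : V) :
    2 ^ I.card * (N (b + (1 / 2 : ℝ) • ∑ i ∈ I, w i) + ∑ i ∈ I, N ((1 / 2 : ℝ) • w i)) ≤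
      ∑ T ∈ I.powerset, N (b + ∑ i ∈ T, w i) := by
  induction I using Finset.induction_on generalizing b with
  | empty => simp
  | insert j I hj ih =>
    rw [Finset.sum_powerset_insert hj, Finset.card_insert_of_notMem hj, Finset.sum_insert hj,
      Finset.sum_insert hj]
    have h1 := ih b
    have h2 := ih (b + w j)
    have h3 : ∑ T ∈ I.powerset, N (b + ∑ i ∈ insert j T, w i) =
        ∑ T ∈ I.powerset, N (b + w j + ∑ i ∈ T, w i) := by
      refine Finset.sum_congr rfl fun T hT => ?_
      rw [Finset.sum_insert fun h => hj (Finset.mem_powerset.1 hT h), add_assoc]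
    rw [h3]
    have h4 := hN (b + (1 / 2 : ℝ) • (w j + ∑ i ∈ I, w i)) ((1 / 2 : ℝ) • w j)
    have e1 : b + (1 / 2 : ℝ) • (w j + ∑ i ∈ I, w i) + (1 / 2 : ℝ) • w j =
        b + w j + (1 / 2 : ℝ) • ∑ i ∈ I, w i := by module
    have e2 : b + (1 / 2 : ℝ) • (w j + ∑ i ∈ I, w i) - (1 / 2 : ℝ) • w j =
        b + (1 / 2 : ℝ) • ∑ i ∈ I, w i := by module
    rw [e1, e2] at h4
    have h5 := mul_le_mul_of_nonneg_left h4 (show (0 : ℝ) ≤ 2 ^ I.card by positivity)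
    rw [pow_succ]
    linarith

end Clarkson

/-! ### General bounds for the two Hadwiger numbers -/

section Hadwiger

variable {X : Type*} [NormedAddCommGroup X] [NormedSpace ℝ X]

theorem IsStrictAntipodalHadwiger.isAntipodalHadwiger {S : Set X}
    (h : IsStrictAntipodalHadwiger S) : IsAntipodalHadwiger S :=
  ⟨h.1, fun x hx y hy hxy => by
    obtain ⟨f, hf, hlt, hb⟩ := h.2 x hx y hy hxy
    exact ⟨f, hf, hlt.le, hb⟩⟩

theorem strictAntipodalHadwiger_le_antipodalHadwiger :
    strictAntipodalHadwiger X ≤ antipodalHadwiger X :=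
  iSup₂_le fun S hS => le_iSup₂_of_le S hS.isAntipodalHadwiger le_rfl

theorem IsAntipodalHadwiger.isAntipodalSet {S : Set X} (h : IsAntipodalHadwiger S) :
    IsAntipodalSet S := fun x hx y hy hxy => by
  obtain ⟨f, -, hlt, hb⟩ := h.2 x hx y hy hxy
  refine ⟨f.toLinearMap, ?_, hb⟩
  change f y < f x
  linarith

theorem ContinuousLinearMap.sub_le_norm_sub {f : StrongDual ℝ X} (hf : ‖f‖ ≤ 1) (x y : X) :
    f x - f y ≤ ‖x - y‖ := by
  rw [← map_sub]
  exact (le_abs_self _).trans (f.le_of_opNorm_le hf _ |>.trans_eq (one_mul _))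

theorem IsAntipodalHadwiger.one_le_norm_sub {S : Set X} (h : IsAntipodalHadwiger S) {x y : X}
    (hx : x ∈ S) (hy : y ∈ S) (hxy : x ≠ y) : 1 ≤ ‖x - y‖ := by
  obtain ⟨f, hf, hlt, -⟩ := h.2 x hx y hy hxy
  exact hlt.trans (ContinuousLinearMap.sub_le_norm_sub hf x y)

theorem IsStrictAntipodalHadwiger.one_lt_norm_sub {S : Set X} (h : IsStrictAntipodalHadwiger S)
    {x y : X} (hx : x ∈ S) (hy : y ∈ S) (hxy : x ≠ y) : 1 < ‖x - y‖ := by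
  obtain ⟨f, hf, hlt, -⟩ := h.2 x hx y hy hxy
  exact hlt.trans_le (ContinuousLinearMap.sub_le_norm_sub hf x y)

theorem Set.exists_finset_card_eq_of_le_encard {α : Type*} {S : Set α} {k : ℕ}
    (h : (k : ℕ∞) ≤ S.encard) : ∃ T : Finset α, (T : Set α) ⊆ S ∧ T.card = k := by
  obtain ⟨t, hts, ht⟩ := Set.exists_subset_encard_eq h
  have hfin : t.Finite := Set.finite_of_encard_eq_coe ht
  refine ⟨hfin.toFinset, by simpa using hts, ?_⟩
  rw [hfin.encard_eq_coe_toFinset_card] at ht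
  exact_mod_cast ht

theorem IsAntipodalSet.encard_le [FiniteDimensional ℝ X] {S : Set X} (h : IsAntipodalSet S) :
    S.encard ≤ ((2 ^ finrank ℝ X : ℕ) : ℕ∞) := by
  by_contra! hlt
  obtain ⟨T, hTS, hT⟩ := Set.exists_finset_card_eq_of_le_encard
    (k := 2 ^ finrank ℝ X + 1) (by exact_mod_cast Order.add_one_le_of_lt hlt)
  have := (h.mono hTS).card_le
  omega

theorem antipodalHadwiger_le [FiniteDimensional ℝ X] :
    antipodalHadwiger X ≤ ((2 ^ finrank ℝ X : ℕ) : ℕ∞) :=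
  iSup₂_le fun _ hS => hS.isAntipodalSet.encard_le

/-- Excluding subsets of size k bounds every admissible set by k - 1, a uniform bound that survives
the supremum and also covers infinite sets. -/
theorem biSup_encard_lt {X : Type*} {P : Set X → Prop} {k : ℕ} (hk : 0 < k)
    (h : ∀ S, P S → ∀ T : Finset X, (T : Set X) ⊆ S → T.card ≠ k) :
    (⨆ (S : Set X) (_ : P S), S.encard) < (k : ℕ∞) := by
  obtain ⟨k, rfl⟩ := Nat.exists_eq_succ_of_ne_zero hk.ne'
  refine lt_of_le_of_lt (b := (k : ℕ∞)) (iSup₂_le fun S hS => ?_)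
    (by exact_mod_cast Nat.lt_succ_self k)
  by_contra! hlt
  obtain ⟨T, hTS, hT⟩ := Set.exists_finset_card_eq_of_le_encard (k := k + 1) (S := S)
    (by exact_mod_cast Order.add_one_le_of_lt hlt)
  exact h S hS T hTS hT

variable {α : Type*} [Fintype α]

theorem card_le_antipodalHadwiger (g : α → X) (hg : ∀ a, ‖g a‖ = 1)
    (h : ∀ a b, a ≠ b → ∃ f : StrongDual ℝ X, ‖f‖ ≤ 1 ∧ 1 ≤ f (g a) - f (g b) ∧
      ∀ c, f (g b) ≤ f (g c) ∧ f (g c) ≤ f (g a)) :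
    (Fintype.card α : ℕ∞) ≤ antipodalHadwiger X := by
  have hinj : Function.Injective g := fun a b hab => by
    by_contra hne
    obtain ⟨f, -, h1, -⟩ := h a b hne
    rw [hab, sub_self] at h1
    linarith
  refine le_iSup₂_of_le (Set.range g) ⟨?_, ?_⟩ ?_
  · rintro _ ⟨a, rfl⟩
    exact mem_sphere_zero_iff_norm.2 (hg a)
  · rintro _ ⟨a, rfl⟩ _ ⟨b, rfl⟩ hab
    obtain ⟨f, hf, h1, h2⟩ := h a b fun he => hab (he ▸ rfl)
    refine ⟨f, hf, h1, ?_⟩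
    rintro _ ⟨c, rfl⟩
    exact h2 c
  · rw [← ENat.card_eq_coe_fintype_card]
    exact hinj.encard_range

theorem card_le_strictAntipodalHadwiger (g : α → X) (hg : ∀ a, ‖g a‖ = 1)
    (h : ∀ a b, a ≠ b → ∃ f : StrongDual ℝ X, ‖f‖ ≤ 1 ∧ 1 < f (g a) - f (g b) ∧
      ∀ c, f (g b) ≤ f (g c) ∧ f (g c) ≤ f (g a)) :
    (Fintype.card α : ℕ∞) ≤ strictAntipodalHadwiger X := by
  have hinj : Function.Injective g := fun a b hab => by
    by_contra hne
    obtain ⟨f, -, h1, -⟩ := h a b hne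
    rw [hab, sub_self] at h1
    linarith
  refine le_iSup₂_of_le (Set.range g) ⟨?_, ?_⟩ ?_
  · rintro _ ⟨a, rfl⟩
    exact mem_sphere_zero_iff_norm.2 (hg a)
  · rintro _ ⟨a, rfl⟩ _ ⟨b, rfl⟩ hab
    obtain ⟨f, hf, h1, h2⟩ := h a b fun he => hab (he ▸ rfl)
    refine ⟨f, hf, h1, ?_⟩
    rintro _ ⟨c, rfl⟩
    exact h2 c
  · rw [← ENat.card_eq_coe_fintype_card]
    exact hinj.encard_range

end Hadwiger

/-! ### Upper bounds in ℓ_p^n for 2 ≤ p < ∞ -/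

section EllP

variable {p : ℝ≥0∞} {n : ℕ}

theorem EllP.norm_rpow (hp : 0 < p.toReal) (x : EllP p n) :
    ‖x‖ ^ p.toReal = ∑ i, |x i| ^ p.toReal := by
  rw [PiLp.norm_eq_sum hp, one_div, Real.rpow_inv_rpow (by positivity) hp.ne']
  rfl

theorem EllP.finrank_eq : finrank ℝ (EllP p n) = n :=
  (WithLp.linearEquiv p ℝ (Fin n → ℝ)).finrank_eq.trans (by simp)

variable [Fact (1 ≤ p)]

/-- The edges of a parallelotope inscribed in the unit sphere of `ℓ_p^n` with `2 ≤ p < ∞`. -/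
theorem EllP.exists_edges (hp2 : 2 ≤ p) (hp : p ≠ ∞) (hn : 0 < n) {S : Finset (EllP p n)}
    (hS : IsAntipodalSet (S : Set (EllP p n))) (hcard : S.card = 2 ^ n)
    (hnorm : ∀ x ∈ S, ‖x‖ = 1) :
    ∃ w : Fin n → EllP p n, (∀ i, ∃ x ∈ S, ∃ y ∈ S, x ≠ y ∧ w i = x - y) ∧
      ∑ i, ‖w i‖ ^ p.toReal ≤ 2 ^ p.toReal := by
  classical
  have hr : 2 ≤ p.toReal := by
    rw [← ENNReal.toReal_ofNat 2]; exact ENNReal.toReal_mono hp hp2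
  have hfr : finrank ℝ (EllP p n) = n := EllP.finrank_eq
  have : Nontrivial (EllP p n) := Module.nontrivial_of_finrank_pos (R := ℝ) (by omega)
  obtain ⟨b, w, hw, hbw⟩ := hS.exists_parallelotope (by rw [hcard, hfr])
  revert w
  rw [hfr]
  intro w hw hbw
  refine ⟨w, fun i => ⟨b + w i, by simpa using hbw {i}, b, by simpa using hbw ∅, by
    simpa using hw i, by simp⟩, ?_⟩
  have hclark : ∀ x h : EllP p n, 2 * (‖x‖ ^ p.toReal + ‖h‖ ^ p.toReal) ≤
      ‖x + h‖ ^ p.toReal + ‖x - h‖ ^ p.toReal := by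
    intro x h
    simp only [EllP.norm_rpow (show 0 < p.toReal by linarith)]
    rw [← Finset.sum_add_distrib, ← Finset.sum_add_distrib, Finset.mul_sum]
    exact Finset.sum_le_sum fun i _ => two_mul_abs_rpow_add_le hr (x i) (h i)
  have hsum := sum_powerset_ge_of_clarkson (N := fun x : EllP p n => ‖x‖ ^ p.toReal) hclark w
    Finset.univ b
  simp only [hnorm _ (hbw _), Real.one_rpow, Finset.sum_const, Finset.card_powerset,
    Finset.card_univ, Fintype.card_fin, nsmul_eq_mul, mul_one, Nat.cast_pow, Nat.cast_ofNat] at hsum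
  have h1 : ‖b + (1 / 2 : ℝ) • ∑ i, w i‖ ^ p.toReal +
      ∑ i, ‖(1 / 2 : ℝ) • w i‖ ^ p.toReal ≤ 1 := by
    refine le_of_mul_le_mul_left ?_ (show (0 : ℝ) < 2 ^ n by positivity)
    rw [mul_one]; exact hsum
  -- The term of the centre of the parallelotope is discarded.
  have h2 : ∑ i, ‖(1 / 2 : ℝ) • w i‖ ^ p.toReal ≤ 1 := by
    have : 0 ≤ ‖b + (1 / 2 : ℝ) • ∑ i, w i‖ ^ p.toReal := by positivity
    linarith
  have h3 : ∑ i, ‖(1 / 2 : ℝ) • w i‖ ^ p.toReal = (∑ i, ‖w i‖ ^ p.toReal) / 2 ^ p.toReal := by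
    rw [Finset.sum_div]
    refine Finset.sum_congr rfl fun i _ => ?_
    rw [norm_smul, Real.mul_rpow (by positivity) (by positivity)]
    rw [Real.norm_of_nonneg (by norm_num), Real.div_rpow (by norm_num) (by norm_num),
      Real.one_rpow]
    ring
  rwa [h3, div_le_one (by positivity)] at h2

theorem EllP.antipodalHadwiger_lt (hp2 : 2 ≤ p) (hp : p ≠ ∞) (hn : 0 < n)
    (h : 2 ^ p.toReal < (n : ℝ)) : antipodalHadwiger (EllP p n) < ((2 ^ n : ℕ) : ℕ∞) := by
  refine biSup_encard_lt (by positivity) fun S hS T hTS hT => ?_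
  obtain ⟨w, hw, hsum⟩ := EllP.exists_edges hp2 hp hn (hS.isAntipodalSet.mono hTS) hT
    fun x hx => mem_sphere_zero_iff_norm.1 (hS.1 (hTS hx))
  have h1 : ∀ i ∈ Finset.univ, (1 : ℝ) ≤ ‖w i‖ ^ p.toReal := fun i _ => by
    obtain ⟨x, hx, y, hy, hxy, e⟩ := hw i
    rw [e]
    exact Real.one_le_rpow (hS.one_le_norm_sub (hTS hx) (hTS hy) hxy) ENNReal.toReal_nonneg
  have h2 := Finset.sum_le_sum h1
  simp only [Finset.sum_const, Finset.card_univ, Fintype.card_fin, nsmul_eq_mul, mul_one] at h2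
  linarith

theorem EllP.strictAntipodalHadwiger_lt (hp2 : 2 ≤ p) (hp : p ≠ ∞) (hn : 0 < n)
    (h : 2 ^ p.toReal ≤ (n : ℝ)) : strictAntipodalHadwiger (EllP p n) < ((2 ^ n : ℕ) : ℕ∞) := by
  refine biSup_encard_lt (by positivity) fun S hS T hTS hT => ?_
  obtain ⟨w, hw, hsum⟩ := EllP.exists_edges hp2 hp hn
    (hS.isAntipodalHadwiger.isAntipodalSet.mono hTS) hT
    fun x hx => mem_sphere_zero_iff_norm.1 (hS.1 (hTS hx))
  have hr : 0 < p.toReal := ENNReal.toReal_pos (by rintro rfl; simp at hp2) hp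
  have h1 : ∀ i ∈ Finset.univ, (1 : ℝ) < ‖w i‖ ^ p.toReal := fun i _ => by
    obtain ⟨x, hx, y, hy, hxy, e⟩ := hw i
    rw [e]
    exact Real.one_lt_rpow (hS.one_lt_norm_sub (hTS hx) (hTS hy) hxy) hr
  have h2 := Finset.sum_lt_sum_of_nonempty ⟨⟨0, hn⟩, Finset.mem_univ _⟩ h1
  simp only [Finset.sum_const, Finset.card_univ, Fintype.card_fin, nsmul_eq_mul, mul_one] at h2
  linarith

end EllP

/-! ### Lower bounds from the cube -/

section Cube

variable {p : ℝ≥0∞} [Fact (1 ≤ p)] {n : ℕ}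

theorem EllP.norm_proj_le (i : Fin n) : ‖PiLp.proj (𝕜 := ℝ) p (fun _ : Fin n => ℝ) i‖ ≤ 1 :=
  ContinuousLinearMap.opNorm_le_bound _ zero_le_one fun x => by
    rw [one_mul]; exact PiLp.norm_apply_le x i

/-- The sign of a Boolean. -/
def boolSign (s : Bool) : ℝ := if s then 1 else -1

theorem abs_boolSign (s : Bool) : |boolSign s| = 1 := by cases s <;> simp [boolSign]

theorem boolSign_eq_neg_of_ne {s t : Bool} (h : s ≠ t) : boolSign t = -boolSign s := by
  cases s <;> cases t <;> simp_all [boolSign]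

theorem boolSign_mul_self_mul (s : Bool) (r : ℝ) : boolSign s * (boolSign s * r) = r := by
  cases s <;> simp [boolSign]

/-- Two points with a coordinate of the form `± r` in a set where this coordinate is always of this
form are separated by the coordinate functional. -/
theorem EllP.exists_coordinate_functional {α : Type*} (g : α → EllP p n) (i : Fin n) {r : ℝ}
    (s : Bool) {a b : α} (ha : g a i = boolSign s * r) (hb : g b i = -(boolSign s * r))
    (hg : ∀ c, |g c i| ≤ r) : ∃ f : StrongDual ℝ (EllP p n), ‖f‖ ≤ 1 ∧ f (g a) - f (g b) = 2 * r ∧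
      ∀ c, f (g b) ≤ f (g c) ∧ f (g c) ≤ f (g a) := by
  refine ⟨boolSign s • PiLp.proj (𝕜 := ℝ) p (fun _ : Fin n => ℝ) i, ?_, ?_, fun c => ?_⟩
  · rw [norm_smul, Real.norm_eq_abs, abs_boolSign, one_mul]
    exact EllP.norm_proj_le i
  · change boolSign s * g a i - boolSign s * g b i = 2 * r
    rw [ha, hb, mul_neg, boolSign_mul_self_mul]; ring
  · change boolSign s * g b i ≤ boolSign s * g c i ∧ boolSign s * g c i ≤ boolSign s * g a i
    rw [ha, hb, mul_neg, boolSign_mul_self_mul, ← abs_le, abs_mul, abs_boolSign, one_mul]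
    exact hg c

/-- The vertex of the cube `[-t, t]ⁿ` with the signs `ε`. -/
def cubeVertex (p : ℝ≥0∞) (t : ℝ) (ε : Fin n → Bool) : EllP p n :=
  WithLp.toLp p fun i => boolSign (ε i) * t

theorem cubeVertex_functional {t : ℝ} (ht : 0 ≤ t) (ε η : Fin n → Bool) (h : ε ≠ η) :
    ∃ f : StrongDual ℝ (EllP p n), ‖f‖ ≤ 1 ∧ f (cubeVertex p t ε) - f (cubeVertex p t η) = 2 * t ∧
      ∀ c, f (cubeVertex p t η) ≤ f (cubeVertex p t c) ∧
        f (cubeVertex p t c) ≤ f (cubeVertex p t ε) := by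
  obtain ⟨i, hi⟩ := Function.ne_iff.1 h
  refine EllP.exists_coordinate_functional (cubeVertex p t) i (ε i) rfl ?_ fun c => ?_
  · change boolSign (η i) * t = _
    rw [boolSign_eq_neg_of_ne hi, neg_mul]
  · change |boolSign (c i) * t| ≤ t
    rw [abs_mul, abs_boolSign, one_mul, abs_of_nonneg ht]

theorem two_pow_le_antipodalHadwiger {t : ℝ} (ht : 1 ≤ 2 * t)
    (hnorm : ∀ ε : Fin n → Bool, ‖cubeVertex p t ε‖ = 1) :
    ((2 ^ n : ℕ) : ℕ∞) ≤ antipodalHadwiger (EllP p n) := by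
  have := card_le_antipodalHadwiger (cubeVertex (n := n) p t) hnorm fun ε η h => by
    obtain ⟨f, h1, h2, h3⟩ := cubeVertex_functional (p := p) (show 0 ≤ t by linarith) ε η h
    exact ⟨f, h1, h2 ▸ ht, h3⟩
  simpa using this

theorem two_pow_le_strictAntipodalHadwiger {t : ℝ} (ht : 1 < 2 * t)
    (hnorm : ∀ ε : Fin n → Bool, ‖cubeVertex p t ε‖ = 1) :
    ((2 ^ n : ℕ) : ℕ∞) ≤ strictAntipodalHadwiger (EllP p n) := by
  have := card_le_strictAntipodalHadwiger (cubeVertex (n := n) p t) hnorm fun ε η h => by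
    obtain ⟨f, h1, h2, h3⟩ := cubeVertex_functional (p := p) (show 0 ≤ t by linarith) ε η h
    exact ⟨f, h1, h2 ▸ ht, h3⟩
  simpa using this

theorem EllP.norm_eq_one_of_sum (hp : 0 < p.toReal) {x : EllP p n}
    (h : ∑ i, |x i| ^ p.toReal = 1) : ‖x‖ = 1 := by
  rw [← EllP.norm_rpow hp] at h
  exact (Real.rpow_left_inj (norm_nonneg x) zero_le_one hp.ne').1 (h.trans (Real.one_rpow _).symm)

theorem norm_cubeVertex (hp : 0 < p.toReal) (hn : 0 < n) (ε : Fin n → Bool) :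
    ‖cubeVertex p ((n : ℝ)⁻¹ ^ (p.toReal)⁻¹) ε‖ = 1 := by
  refine EllP.norm_eq_one_of_sum hp ?_
  have : ∀ i, |cubeVertex p ((n : ℝ)⁻¹ ^ (p.toReal)⁻¹) ε i| ^ p.toReal = (n : ℝ)⁻¹ := fun i => by
    change |boolSign (ε i) * _| ^ p.toReal = _
    rw [abs_mul, abs_boolSign, one_mul, abs_of_nonneg (by positivity),
      Real.rpow_inv_rpow (by positivity) hp.ne']
  simp only [this, Finset.sum_const, Finset.card_univ, Fintype.card_fin, nsmul_eq_mul]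
  exact mul_inv_cancel₀ (by positivity)

theorem EllP.antipodalHadwiger_ge_two_pow (hp : 0 < p.toReal) (hn : 0 < n)
    (h : (n : ℝ) ≤ 2 ^ p.toReal) : ((2 ^ n : ℕ) : ℕ∞) ≤ antipodalHadwiger (EllP p n) := by
  refine two_pow_le_antipodalHadwiger (t := (n : ℝ)⁻¹ ^ (p.toReal)⁻¹) ?_ (norm_cubeVertex hp hn)
  have : (2 : ℝ)⁻¹ ≤ (n : ℝ)⁻¹ ^ (p.toReal)⁻¹ := by
    rw [Real.le_rpow_inv_iff_of_pos (by norm_num) (by positivity) hp,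
      Real.inv_rpow (by norm_num)]
    exact inv_anti₀ (by positivity) h
  linarith

theorem EllP.strictAntipodalHadwiger_ge_two_pow (hp : 0 < p.toReal) (hn : 0 < n)
    (h : (n : ℝ) < 2 ^ p.toReal) : ((2 ^ n : ℕ) : ℕ∞) ≤ strictAntipodalHadwiger (EllP p n) := by
  refine two_pow_le_strictAntipodalHadwiger (t := (n : ℝ)⁻¹ ^ (p.toReal)⁻¹) ?_
    (norm_cubeVertex hp hn)
  have : (2 : ℝ)⁻¹ < (n : ℝ)⁻¹ ^ (p.toReal)⁻¹ := by
    rw [Real.lt_rpow_inv_iff_of_pos (by norm_num) (by positivity) hp,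
      Real.inv_rpow (by norm_num)]
    exact inv_strictAnti₀ (by positivity) h
  linarith

theorem EllP.strictAntipodalHadwiger_top_ge (hn : 0 < n) :
    ((2 ^ n : ℕ) : ℕ∞) ≤ strictAntipodalHadwiger (EllP ∞ n) := by
  refine two_pow_le_strictAntipodalHadwiger (t := 1) (by norm_num) fun ε => ?_
  have : Nonempty (Fin n) := ⟨⟨0, hn⟩⟩
  rw [PiLp.norm_eq_ciSup]
  have : ∀ i, ‖cubeVertex ∞ 1 ε i‖ = 1 := fun i => by
    change |boolSign (ε i) * 1| = 1
    rw [mul_one, abs_boolSign]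
  simp [this]

end Cube

/-! ### Lower bound from a prism over a cross-polytope -/

section Prism

variable {p : ℝ≥0∞} {n : ℕ}

/-- The vertex `(± b, ± a eᵢ)` of a prism over a cross-polytope. -/
noncomputable def prismVertex (p : ℝ≥0∞) (a b : ℝ) (v : Fin n × Bool × Bool) : EllP p (n + 1) :=
  WithLp.toLp p (Fin.cons (boolSign v.2.2 * b) (Pi.single v.1 (boolSign v.2.1 * a)))

theorem prismVertex_zero (a b : ℝ) (v : Fin n × Bool × Bool) :
    prismVertex p a b v 0 = boolSign v.2.2 * b := rfl

theorem prismVertex_succ (a b : ℝ) (v : Fin n × Bool × Bool) (i : Fin n) :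
    prismVertex p a b v i.succ = if i = v.1 then boolSign v.2.1 * a else 0 := by
  change (Pi.single v.1 (boolSign v.2.1 * a) : Fin n → ℝ) i = _
  rw [Pi.single_apply]

variable [Fact (1 ≤ p)]

theorem norm_prismVertex (hp : 0 < p.toReal) {a b : ℝ} (ha : 0 ≤ a) (hb : 0 ≤ b)
    (hab : a ^ p.toReal + b ^ p.toReal = 1) (v : Fin n × Bool × Bool) :
    ‖prismVertex p a b v‖ = 1 := by
  refine EllP.norm_eq_one_of_sum hp ?_
  rw [Fin.sum_univ_succ, Finset.sum_eq_single v.1]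
  · rw [prismVertex_zero, prismVertex_succ, if_pos rfl, abs_mul, abs_mul, abs_boolSign,
      abs_boolSign, one_mul, one_mul, abs_of_nonneg ha, abs_of_nonneg hb, add_comm, hab]
  · intro i _ hi
    rw [prismVertex_succ, if_neg hi, abs_zero, Real.zero_rpow hp.ne']
  · simp

/-- The power mean inequality in two coordinates; it bounds the dual norm of ± eᵢ ± eⱼ. -/
theorem EllP.abs_add_abs_le (hp : 1 ≤ p.toReal) (x : EllP p n) {i j : Fin n} (hij : i ≠ j) :
    |x i| + |x j| ≤ 2 ^ (1 - (p.toReal)⁻¹) * ‖x‖ := by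
  have hp0 : 0 < p.toReal := by linarith
  have h1 : (|x i| + |x j|) ^ p.toReal ≤ 2 ^ (p.toReal - 1) * ‖x‖ ^ p.toReal := by
    have h2 := NNReal.rpow_add_le_mul_rpow_add_rpow ‖x i‖₊ ‖x j‖₊ hp
    have h3 : (|x i| + |x j|) ^ p.toReal ≤
        2 ^ (p.toReal - 1) * (|x i| ^ p.toReal + |x j| ^ p.toReal) := by
      have := NNReal.coe_le_coe.2 h2
      push_cast at this
      exact this
    refine h3.trans (mul_le_mul_of_nonneg_left ?_ (by positivity))
    rw [EllP.norm_rpow hp0, ← Finset.sum_pair hij (f := fun k => |x k| ^ p.toReal)]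
    exact Finset.sum_le_sum_of_subset_of_nonneg (Finset.subset_univ _)
      fun _ _ _ => by positivity
  have h4 : (2 ^ (1 - (p.toReal)⁻¹) * ‖x‖) ^ p.toReal =
      2 ^ (p.toReal - 1) * ‖x‖ ^ p.toReal := by
    rw [Real.mul_rpow (by positivity) (by positivity), ← Real.rpow_mul (by norm_num), sub_mul,
      inv_mul_cancel₀ hp0.ne', one_mul]
  rw [← h4] at h1
  exact (Real.rpow_le_rpow_iff (by positivity) (by positivity) hp0).1 h1

theorem prismVertex_functional (hp : 1 ≤ p.toReal) {a b : ℝ} (ha : 1 < 2 ^ (p.toReal)⁻¹ * a)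
    (hb : 1 < 2 * b) (u v : Fin n × Bool × Bool) (huv : u ≠ v) :
    ∃ f : StrongDual ℝ (EllP p (n + 1)), ‖f‖ ≤ 1 ∧
      1 < f (prismVertex p a b u) - f (prismVertex p a b v) ∧
      ∀ c, f (prismVertex p a b v) ≤ f (prismVertex p a b c) ∧
        f (prismVertex p a b c) ≤ f (prismVertex p a b u) := by
  have hp0 : 0 < p.toReal := by linarith
  have ha0 : 0 < a := pos_of_mul_pos_right (zero_lt_one.trans ha) (by positivity)
  have hb0 : 0 < b := by linarith
  have hsucc : ∀ (c : Fin n × Bool × Bool) (i : Fin n), |prismVertex p a b c i.succ| ≤ a := fun c i => by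
    rw [prismVertex_succ]
    split_ifs
    · rw [abs_mul, abs_boolSign, one_mul, abs_of_pos ha0]
    · simpa using ha0.le
  by_cases h2 : u.2.2 = v.2.2
  · by_cases h1 : u.1 = v.1
    · have h3 : u.2.1 ≠ v.2.1 := fun h3 => huv (Prod.ext h1 (Prod.ext h3 h2))
      obtain ⟨f, hf, hlt, hb⟩ := EllP.exists_coordinate_functional (prismVertex p a b) u.1.succ
        u.2.1 (a := u) (b := v) (by rw [prismVertex_succ, if_pos rfl])
        (by rw [prismVertex_succ, if_pos h1, boolSign_eq_neg_of_ne h3, neg_mul])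
        (fun c => hsucc c _)
      refine ⟨f, hf, ?_, hb⟩
      rw [hlt]
      refine ha.trans_le (mul_le_mul_of_nonneg_right ?_ ha0.le)
      calc (2 : ℝ) ^ (p.toReal)⁻¹ ≤ 2 ^ (1 : ℝ) :=
            Real.rpow_le_rpow_of_exponent_le (by norm_num) (inv_le_one_of_one_le₀ hp)
        _ = 2 := Real.rpow_one 2
    -- On different axes of the same base, a signed combination of the two coordinates separates u
    -- from v. The factor k normalises its dual norm, and the gap becomes 2 k a = 2^(1/p) a.
    · set k : ℝ := 2 ^ ((p.toReal)⁻¹ - 1) with hk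
      have hk0 : 0 < k := by positivity
      have hk2 : k * 2 = 2 ^ (p.toReal)⁻¹ := by
        rw [hk, Real.rpow_sub_one (by norm_num)]; field_simp
      let f : StrongDual ℝ (EllP p (n + 1)) :=
        k • (boolSign u.2.1 • PiLp.proj (𝕜 := ℝ) p (fun _ : Fin (n + 1) => ℝ) u.1.succ -
          boolSign v.2.1 • PiLp.proj (𝕜 := ℝ) p (fun _ : Fin (n + 1) => ℝ) v.1.succ)
      have hf : ∀ x, f x = k * (boolSign u.2.1 * x u.1.succ - boolSign v.2.1 * x v.1.succ) :=
        fun x => rfl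
      have hfu : f (prismVertex p a b u) = k * a := by
        rw [hf, prismVertex_succ, prismVertex_succ, if_pos rfl, if_neg (Ne.symm h1),
          boolSign_mul_self_mul, mul_zero, sub_zero]
      have hfv : f (prismVertex p a b v) = -(k * a) := by
        rw [hf, prismVertex_succ, prismVertex_succ, if_pos rfl, if_neg h1,
          boolSign_mul_self_mul, mul_zero, zero_sub, mul_neg]
      refine ⟨f, ?_, ?_, fun c => ?_⟩
      · refine ContinuousLinearMap.opNorm_le_bound _ zero_le_one fun x => ?_
        have h4 := EllP.abs_add_abs_le hp x
          (fun h => h1 (Fin.succ_injective _ h) : u.1.succ ≠ v.1.succ)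
        have h5 : k * 2 ^ (1 - (p.toReal)⁻¹) = 1 := by
          rw [hk, ← Real.rpow_add (by norm_num)]; simp
        rw [hf, Real.norm_eq_abs, abs_mul, abs_of_pos hk0]
        calc k * |boolSign u.2.1 * x u.1.succ - boolSign v.2.1 * x v.1.succ|
            ≤ k * (|x u.1.succ| + |x v.1.succ|) := by
              gcongr
              refine (abs_sub _ _).trans_eq ?_
              rw [abs_mul, abs_mul, abs_boolSign, abs_boolSign, one_mul, one_mul]
          _ ≤ k * (2 ^ (1 - (p.toReal)⁻¹) * ‖x‖) := by gcongr
          _ = 1 * ‖x‖ := by rw [← mul_assoc, h5]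
      · rw [hfu, hfv]
        calc 1 < 2 ^ (p.toReal)⁻¹ * a := ha
          _ = _ := by rw [← hk2]; ring
      · rw [hfu, hfv, ← abs_le, hf, abs_mul, abs_of_pos hk0, prismVertex_succ, prismVertex_succ]
        gcongr
        by_cases hcu : u.1 = c.1
        · rw [if_pos hcu, if_neg fun h => h1 (hcu.trans h.symm), mul_zero, sub_zero, abs_mul,
            abs_mul, abs_boolSign, abs_boolSign, abs_of_pos ha0, one_mul, one_mul]
        · rw [if_neg hcu, mul_zero, zero_sub, abs_neg, abs_mul, abs_boolSign, one_mul]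
          split_ifs
          · rw [abs_mul, abs_boolSign, one_mul, abs_of_pos ha0]
          · simpa using ha0.le
  · obtain ⟨f, hf, hlt, hbd⟩ := EllP.exists_coordinate_functional (prismVertex p a b) 0
      u.2.2 (a := u) (b := v) rfl
      (by rw [prismVertex_zero, boolSign_eq_neg_of_ne h2, neg_mul])
      (fun c => by rw [prismVertex_zero, abs_mul, abs_boolSign, one_mul, abs_of_pos hb0])
    exact ⟨f, hf, hlt ▸ hb, hbd⟩

theorem EllP.four_mul_le_strictAntipodalHadwiger (hp : 1 < p.toReal) :
    ((4 * n : ℕ) : ℕ∞) ≤ strictAntipodalHadwiger (EllP p (n + 1)) := by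
  have hp0 : 0 < p.toReal := by linarith
  have hlt : (2 : ℝ)⁻¹ ^ p.toReal < 2⁻¹ := by
    have := Real.rpow_lt_rpow_of_exponent_gt (show (0 : ℝ) < 2⁻¹ by norm_num) (by norm_num) hp
    rwa [Real.rpow_one] at this
  -- β is b^p: the gap 2b > 1 needs β > 2^(-p), and 2^(1/p) a > 1 with a^p = 1 - β needs β < 1/2.
  -- Both are possible because p > 1.
  obtain ⟨β, hβ, hβ2⟩ := exists_between hlt
  have hβ0 : 0 < β := lt_trans (by positivity) hβ
  have ha0 : 0 < 1 - β := by linarith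
  have h := card_le_strictAntipodalHadwiger
    (prismVertex (n := n) p ((1 - β) ^ (p.toReal)⁻¹) (β ^ (p.toReal)⁻¹))
    (norm_prismVertex hp0 (by positivity) (by positivity) (by
      rw [Real.rpow_inv_rpow ha0.le hp0.ne', Real.rpow_inv_rpow hβ0.le hp0.ne']; ring))
    (prismVertex_functional hp.le ?_ ?_)
  · have e : Fintype.card (Fin n × Bool × Bool) = 4 * n := by simp; ring
    rwa [e] at h
  · rw [← Real.mul_rpow (by norm_num) ha0.le]
    exact Real.one_lt_rpow (by linarith) (inv_pos.2 hp0)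
  · have := (Real.lt_rpow_inv_iff_of_pos (by norm_num) hβ0.le hp0).2 hβ
    linarith

end Prism

/-! ### Assembly of the cases -/

section Main

variable {p : ℝ≥0∞} [Fact (1 ≤ p)] {n : ℕ}

theorem EllP.antipodalHadwiger_le_two_pow :
    antipodalHadwiger (EllP p n) ≤ ((2 ^ n : ℕ) : ℕ∞) := by
  have := antipodalHadwiger_le (X := EllP p n)
  rwa [EllP.finrank_eq] at this

theorem four_mul_sub_le_two_pow (hn : 2 ≤ n) : 4 * n - 4 ≤ 2 ^ n := by
  induction n, hn using Nat.le_induction with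
  | base => norm_num
  | succ n hn ih =>
    rw [pow_succ]
    have : 2 ^ 2 ≤ 2 ^ n := Nat.pow_le_pow_right (by norm_num) hn
    omega

theorem EllP.four_mul_sub_le_strictAntipodalHadwiger (hp : 1 < p) (hn : 2 ≤ n) :
    ((4 * n - 4 : ℕ) : ℕ∞) ≤ strictAntipodalHadwiger (EllP p n) := by
  rcases eq_or_ne p ∞ with rfl | hpt
  · exact (Nat.cast_le.2 (four_mul_sub_le_two_pow hn)).trans
      (EllP.strictAntipodalHadwiger_top_ge (by omega))
  · obtain ⟨m, rfl⟩ := Nat.exists_eq_add_of_le' (show 1 ≤ n by omega)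
    have h1 : 1 < p.toReal := by
      rw [← ENNReal.toReal_one]; exact (ENNReal.toReal_lt_toReal (by simp) hpt).2 hp
    have e : 4 * (m + 1) - 4 = 4 * m := by omega
    rw [e]
    exact EllP.four_mul_le_strictAntipodalHadwiger h1

theorem EllP.strictAntipodalHadwiger_eq_of_logTwo_lt (hn : 0 < n) (h : logTwo n < p) :
    strictAntipodalHadwiger (EllP p n) = ((2 ^ n : ℕ) : ℕ∞) := by
  refine le_antisymm
    (strictAntipodalHadwiger_le_antipodalHadwiger.trans EllP.antipodalHadwiger_le_two_pow) ?_
  rcases eq_or_ne p ∞ with rfl | hpt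
  · exact EllP.strictAntipodalHadwiger_top_ge hn
  · have hn1 : (1 : ℝ) ≤ n := by exact_mod_cast hn
    rw [logTwo, ENNReal.ofReal_lt_iff_lt_toReal (Real.logb_nonneg (by norm_num) hn1) hpt,
      Real.logb_lt_iff_lt_rpow (by norm_num) (by linarith)] at h
    refine EllP.strictAntipodalHadwiger_ge_two_pow ?_ hn h
    exact ENNReal.toReal_pos (zero_lt_one.trans_le Fact.out).ne' hpt

theorem EllP.antipodalHadwiger_eq_of_two_pow_le
    (h : ((2 ^ n : ℕ) : ℕ∞) ≤ strictAntipodalHadwiger (EllP p n)) :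
    antipodalHadwiger (EllP p n) = ((2 ^ n : ℕ) : ℕ∞) :=
  le_antisymm EllP.antipodalHadwiger_le_two_pow
    (h.trans strictAntipodalHadwiger_le_antipodalHadwiger)

theorem EllP.hadwiger_of_eq_logTwo (hn : 4 ≤ n) (h : p = logTwo n) :
    strictAntipodalHadwiger (EllP p n) < ((2 ^ n : ℕ) : ℕ∞) ∧
      antipodalHadwiger (EllP p n) = ((2 ^ n : ℕ) : ℕ∞) := by
  have hn4 : (4 : ℝ) ≤ n := by exact_mod_cast hn
  have hlog : 2 ≤ Real.logb 2 n := by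
    rw [Real.le_logb_iff_rpow_le (by norm_num) (by linarith)]; norm_num; exact hn
  have hpt : p ≠ ∞ := by rw [h]; exact ENNReal.ofReal_ne_top
  have hpr : p.toReal = Real.logb 2 n := by
    rw [h]; exact ENNReal.toReal_ofReal (by linarith)
  have hp2 : 2 ≤ p := by
    rw [h, logTwo, ← ENNReal.ofReal_ofNat]; exact ENNReal.ofReal_le_ofReal hlog
  have he : (2 : ℝ) ^ p.toReal = n := by
    rw [hpr, Real.rpow_logb (by norm_num) (by norm_num) (by linarith)]
  exact ⟨EllP.strictAntipodalHadwiger_lt hp2 hpt (by omega) he.le,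
    le_antisymm EllP.antipodalHadwiger_le_two_pow
      (EllP.antipodalHadwiger_ge_two_pow (by linarith) (by omega) he.ge)⟩

theorem logTwo_four : logTwo 4 = 2 := by
  have : Real.logb 2 ((4 : ℕ) : ℝ) = 2 := by
    rw [Real.logb_eq_iff_rpow_eq (by norm_num) (by norm_num) (by norm_num)]; norm_num
  rw [logTwo, this, ENNReal.ofReal_ofNat]

end Main

theorem theorem1 (p : ℝ≥0∞) [Fact (1 ≤ p)] (hp : 1 < p) (n : ℕ) :
    ((n = 2 ∨ n = 3) →
      strictAntipodalHadwiger (EllP p n) = ((4 * n - 4 : ℕ) : ℕ∞) ∧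
      4 * n - 4 = 2 ^ n ∧
      antipodalHadwiger (EllP p n) = ((2 ^ n : ℕ) : ℕ∞)) ∧
    (4 ≤ n →
      ((4 * n - 4 : ℕ) : ℕ∞) ≤ strictAntipodalHadwiger (EllP p n) ∧
      (2 ≤ p → p < logTwo n →
        strictAntipodalHadwiger (EllP p n) ≤ antipodalHadwiger (EllP p n) ∧
        antipodalHadwiger (EllP p n) < ((2 ^ n : ℕ) : ℕ∞)) ∧
      (p = logTwo n →
        strictAntipodalHadwiger (EllP p n) < ((2 ^ n : ℕ) : ℕ∞) ∧
        antipodalHadwiger (EllP p n) = ((2 ^ n : ℕ) : ℕ∞)) ∧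
      (logTwo n < p →
        strictAntipodalHadwiger (EllP p n) = ((2 ^ n : ℕ) : ℕ∞) ∧
        antipodalHadwiger (EllP p n) = ((2 ^ n : ℕ) : ℕ∞))) ∧
    (logTwo 4 = 2 ∧
      12 ≤ strictAntipodalHadwiger (EllP 2 4) ∧
      strictAntipodalHadwiger (EllP 2 4) < 16 ∧
      antipodalHadwiger (EllP 2 4) = 16) := by
  refine ⟨fun hn => ?_, fun hn => ⟨?_, fun hp2 hlt => ⟨?_, ?_⟩, fun h => ?_, fun h => ?_⟩, ?_⟩
  · have e : 4 * n - 4 = 2 ^ n := by rcases hn with rfl | rfl <;> norm_num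
    have hge := EllP.four_mul_sub_le_strictAntipodalHadwiger hp (show 2 ≤ n by omega)
    rw [e] at hge ⊢
    exact ⟨le_antisymm (strictAntipodalHadwiger_le_antipodalHadwiger.trans
      EllP.antipodalHadwiger_le_two_pow) hge, rfl, EllP.antipodalHadwiger_eq_of_two_pow_le hge⟩
  · exact EllP.four_mul_sub_le_strictAntipodalHadwiger hp (by omega)
  · exact strictAntipodalHadwiger_le_antipodalHadwiger
  · have hpt : p ≠ ∞ := (hlt.trans_le le_top).ne
    rw [logTwo, ENNReal.lt_ofReal_iff_toReal_lt hpt,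
      Real.lt_logb_iff_rpow_lt (by norm_num) (by positivity)] at hlt
    exact EllP.antipodalHadwiger_lt hp2 hpt (by omega) hlt
  · exact EllP.hadwiger_of_eq_logTwo hn h
  · have hs := EllP.strictAntipodalHadwiger_eq_of_logTwo_lt (by omega) h
    exact ⟨hs, EllP.antipodalHadwiger_eq_of_two_pow_le hs.ge⟩
  · have h4 := EllP.hadwiger_of_eq_logTwo (p := 2) le_rfl logTwo_four.symm
    exact ⟨logTwo_four, EllP.four_mul_sub_le_strictAntipodalHadwiger (p := 2) (n := 4)
      (by norm_num) (by norm_num), h4.1, h4.2⟩
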